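/- Write $(b;q)_n=\prod_{k=0}^{n-1}(1-bq^k)$, $(b;q)_\infty=\prod_{k=0}^{\infty}(1-bq^k)$, and $\ell_k=(q^k;q^k)_\infty$ for $k\ge 1$. Let $f(c,d)=\sum_{m=-\infty}^{\infty}c^{m(m+1)/2}d^{m(m-1)/2}$ and $\psi(q)=f(q,q^3)$. Let $P_v(n)$ be the coefficients of the eighth order mock theta function $$\sum_{n=0}^{\infty}P_v(n)q^n=v(q)=\sum_{n=0}^{\infty}\frac{q^{(n+1)^2}(-q;q^2)_n}{(q;q^2)_{n+1}}.$$ A congruence modulo $m$ between power series with integer coefficients means congruence modulo $m$ of all corresponding coefficients, and $\left(\frac{\cdot}{p}\right)$ is the Legendre symbol. **Theorem.** (i) For every integer $n\ge 0$, $P_v(6n+5)\equiv 0\pmod 3$. (ii) Let $p\ge 3$ be a prime with $\left(\frac{-2}{p}\right)=-1$. Then for every integer $\alpha\ge 0$, $$\sum_{n=0}^{\infty}P_v\left(2p^{2\alpha}n+\frac{3p^{2\alpha}+1}{4}\right)q^n\equiv\psi(q)\psi(q^2)\pmod 2,$$ and for all integers $n\ge 0$ and $1\le j\le p-1$, $$P_v\left(2p^{2\alpha+2}n+2p^{2\alpha+1}j+\frac{3p^{2\alpha+2}+1}{4}\right)\equiv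 0\pmod 2.$$ (iii) Let $p\ge 5$ be a prime with $\left(\frac{-18}{p}\right)=-1$. Then for every integer $\alpha\ge 0$, $$\sum_{n=0}^{\infty}P_v\left(6p^{2\alpha}n+\frac{19p^{2\alpha}+1}{4}\right)q^n\equiv 3\ell_1\ell_6^3\pmod 6,$$ and for all integers $n\ge 0$ and $1\le j\le p-1$, $$P_v\left(6p^{2\alpha+2}n+6p^{2\alpha+1}j+\frac{19p^{2\alpha+2}+1}{4}\right)\equiv 0\pmod 6.$$ -/

import Mathlib

open scoped PowerSeries.WithPiTopology

namespace MockTheta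

open PowerSeries

noncomputable section

/-! All `q`-series are formal power series in `q = X` over `ℤ`; infinite sums and products are taken
in the topology of coefficientwise convergence (with `ℤ` discrete). -/

/-- `(b; q)_n = ∏_{k=0}^{n-1} (1 - b q^k)`. -/
def qPoch (b q : ℤ⟦X⟧) (n : ℕ) : ℤ⟦X⟧ :=
  ∏ k ∈ Finset.range n, (1 - b * q ^ k)

/-- `(b; q)_∞ = ∏_{k=0}^∞ (1 - b q^k)`. -/
def qPochInf (b q : ℤ⟦X⟧) : ℤ⟦X⟧ :=
  ∏' k : ℕ, (1 - b * q ^ k)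

/-- `ℓ_k = (q^k; q^k)_∞`, for `k ≥ 1`. -/
def ell (k : ℕ) : ℤ⟦X⟧ :=
  qPochInf (X ^ k) (X ^ k)

/-- Ramanujan's general theta function `f(c, d) = ∑_{m ∈ ℤ} c^{m(m+1)/2} d^{m(m-1)/2}`.
Both exponents are nonnegative integers. -/
def theta (c d : ℤ⟦X⟧) : ℤ⟦X⟧ :=
  ∑' m : ℤ, c ^ (m * (m + 1) / 2).toNat * d ^ (m * (m - 1) / 2).toNat

/-- `ψ(q) = f(q, q^3)`. -/
def psi (q : ℤ⟦X⟧) : ℤ⟦X⟧ :=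
  theta q (q ^ 3)

/-- The `n`-th term `q^{(n+1)^2} (-q; q^2)_n / (q; q^2)_{n+1}` of `v(q)`. The denominator has constant
coefficient `1`, and `invOfUnit _ 1` is its inverse. -/
def vTerm (n : ℕ) : ℤ⟦X⟧ :=
  X ^ ((n + 1) ^ 2) * qPoch (-X) (X ^ 2) n * invOfUnit (qPoch X (X ^ 2) (n + 1)) 1

/-- The mock theta function `v(q) = ∑_{n ≥ 0} q^{(n+1)^2} (-q; q^2)_n / (q; q^2)_{n+1}`. -/
def v : ℤ⟦X⟧ :=
  ∑' n : ℕ, vTerm n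

/-- `∑_{n ≥ 0} P_v(n) q^n = v(q)`. -/
def Pv (n : ℕ) : ℤ :=
  coeff n v

/-- Congruence modulo `m` of power series with integer coefficients. -/
def SeriesModEq (m : ℤ) (f g : ℤ⟦X⟧) : Prop :=
  ∀ n : ℕ, coeff n f ≡ coeff n g [ZMOD m]

/-! The inverse, the sums and the products used above are genuine ones. -/

theorem qPoch_mul_invOfUnit (n : ℕ) :
    qPoch X (X ^ 2) n * invOfUnit (qPoch X (X ^ 2) n) 1 = 1 := by
  apply mul_invOfUnit
  simp [qPoch]

theorem summable_vTerm : Summable vTerm := by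
  apply WithPiTopology.summable_of_tendsto_order_atTop_nhds_top
  refine ENat.tendsto_nhds_top_iff_natCast_lt.mpr fun n => Filter.eventually_atTop.mpr ⟨n, ?_⟩
  intro m hm
  have h : (((m + 1) ^ 2 : ℕ) : ℕ∞) ≤ (vTerm m).order := by
    unfold vTerm
    rw [mul_assoc]
    refine le_trans ?_ (le_order_mul _ _)
    rw [order_X_pow]
    exact le_self_add
  refine lt_of_lt_of_le ?_ h
  norm_cast
  nlinarith

theorem multipliable_ell {k : ℕ} (hk : 0 < k) :
    Multipliable fun i : ℕ => (1 : ℤ⟦X⟧) - X ^ k * (X ^ k) ^ i := by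
  simp_rw [sub_eq_add_neg]
  apply WithPiTopology.multipliable_one_add_of_tendsto_order_atTop_nhds_top
  refine ENat.tendsto_nhds_top_iff_natCast_lt.mpr fun n => Filter.eventually_atTop.mpr ⟨n, ?_⟩
  intro m hm
  rw [order_neg, ← pow_mul, ← pow_add, order_X_pow]
  norm_cast
  nlinarith

theorem summable_psi {k : ℕ} (hk : 0 < k) :
    Summable fun m : ℤ => ((X : ℤ⟦X⟧) ^ k) ^ (m * (m + 1) / 2).toNat *
      (((X : ℤ⟦X⟧) ^ k) ^ 3) ^ (m * (m - 1) / 2).toNat := by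
  rw [WithPiTopology.summable_iff_summable_coeff]
  intro n
  apply summable_of_hasFiniteSupport
  refine (Set.finite_Icc (-(n : ℤ) - 1) (n + 1)).subset ?_
  intro m hm
  rw [Function.mem_support] at hm
  contrapose! hm
  rw [← pow_mul, ← pow_mul, ← pow_mul, ← pow_add, coeff_X_pow, if_neg]
  intro h
  apply hm
  have h0 : (m * (m + 1) / 2).toNat ≤ n := by nlinarith
  have h1 : m * (m + 1) / 2 ≤ n := by omega
  have h2 : m * (m + 1) ≤ 2 * n + 1 := by omega
  constructor <;> nlinarith

end

end MockTheta

open scoped PowerSeries.WithPiTopology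

namespace MockTheta

open PowerSeries

noncomputable section

/-! The heart is a product formula for the odd part of $v$: $\sum
P_v(2n+1)q^n=\psi(q^2)(-q^2;q^2)_\infty/(q;q^2)_\infty$ (`oddPart_mul_qPochInf`). Put
$S_s(\nu)=\sum_j s^jq^{(j-\nu)^2}/(q^2;q^2)_j$ (`sqSum`). After multiplication by
$S_{-1}(0)S_1(0)=(q^2;q^4)_\infty$, the $n$-th term of $v(q)$ is $S_{-1}(-n-1)S_1(n)$, and the
$n$-th term of $-v(-q)$ is the same expression at the index $-n-1$. So $v(q)-v(-q)$ is one sum over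
all of $\mathbb Z$. Expanding both factors and shearing the index gives exponents $(m+1)^2+(N-m)^2$
that depend only on $m$ and $N=j+k$. The signed sum of the coefficients over $j+k=N$ is $0$ for odd
$N$ and $1/(q^4;q^4)_{N/2}$ for even $N$; the sum over $m$ then yields $2\psi(q^4)$, and Euler's
identity sums over $N$.

Modulo 3: the odd part times the cube of an invertible product is $\sum(-1)^mq^{m^2}$. The cube is a
series in $q^3$ modulo 3, and no square is $2$ modulo 3.

Modulo 2: the odd part becomes $\psi(q)\psi(q^2)$, so for odd $m$, $P_v(m)$ has the parity of the
number of representations $4m-1=x^2+2y^2$ with $x,y\ge 0$ (`Pv_modEq_repCount`). The series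
$\ell_1\ell_6^3$ counts, modulo 2, the representations of $24n+19$ by the same form. If $-2$ is not
a square modulo $p$, then $p\mid x^2+2y^2$ forces $p\mid x,y$. Hence factors $p^2$ can be removed
without changing the count, and a number divisible by $p$ to an exact odd power has no
representation. This gives both infinite families; the modulus 6 combines 2 and 3. -/

/-! ### Convergence of $q$-series and $q$-products -/

/-- A family of power series indexed by `ι` whose orders tend to infinity is summable. -/
theorem summable_of_X_pow_dvd {ι : Type*} {f : ι → ℤ⟦X⟧} (g : ι → ℕ) (hfg : ∀ i, X ^ g i ∣ f i)
    (hg : ∀ n, {i | g i ≤ n}.Finite) : Summable f := by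
  rw [WithPiTopology.summable_iff_summable_coeff]
  intro n
  apply summable_of_hasFiniteSupport
  refine (hg n).subset fun i hi => ?_
  rw [Function.mem_support] at hi
  by_contra h
  exact hi (X_pow_dvd_iff.mp (hfg i) n (by simpa using h))

theorem multipliable_one_sub_of_X_pow_dvd {f : ℕ → ℤ⟦X⟧} (hf : ∀ i, X ^ i ∣ f i) :
    Multipliable fun i => 1 - f i := by
  simp_rw [sub_eq_add_neg]
  apply WithPiTopology.multipliable_one_add_of_tendsto_order_atTop_nhds_top
  refine ENat.tendsto_nhds_top_iff_natCast_lt.mpr fun n => Filter.eventually_atTop.mpr ⟨n + 1, ?_⟩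
  intro m hm
  rw [order_neg]
  refine lt_of_lt_of_le ?_ (le_order _ m fun i hi => X_pow_dvd_iff.mp (hf m) i (by simpa using hi))
  exact_mod_cast hm

theorem X_pow_dvd_mul_pow {b q : ℤ⟦X⟧} (hq : X ∣ q) (i : ℕ) : X ^ i ∣ b * q ^ i :=
  Dvd.dvd.mul_left (pow_dvd_pow_of_dvd hq i) b

theorem multipliable_qPochInf (b : ℤ⟦X⟧) {q : ℤ⟦X⟧} (hq : X ∣ q) :
    Multipliable fun k : ℕ => 1 - b * q ^ k :=
  multipliable_one_sub_of_X_pow_dvd (X_pow_dvd_mul_pow hq)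

theorem constantCoeff_qPoch {b : ℤ⟦X⟧} (hb : X ∣ b) (q : ℤ⟦X⟧) (n : ℕ) :
    constantCoeff (qPoch b q n) = 1 := by
  simp [qPoch, map_prod, X_dvd_iff.mp hb]

theorem qPoch_succ (b q : ℤ⟦X⟧) (n : ℕ) : qPoch b q (n + 1) = qPoch b q n * (1 - b * q ^ n) :=
  Finset.prod_range_succ _ _

theorem qPochInf_eq_mul (b : ℤ⟦X⟧) {q : ℤ⟦X⟧} (hq : X ∣ q) (n : ℕ) :
    qPochInf b q = qPoch b q n * qPochInf (b * q ^ n) q := by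
  induction n with
  | zero => simp [qPoch]
  | succ n ih =>
    rw [ih, qPoch_succ, mul_assoc]
    congr 1
    have h := (multipliable_qPochInf (b * q ^ n) hq)
    have h2 := (multipliable_qPochInf (b * q ^ (n + 1)) hq)
    rw [qPochInf, tprod_eq_zero_mul', pow_zero, mul_one, qPochInf]
    · congr 1
      exact tprod_congr fun k => by ring
    · refine h2.congr fun k => ?_
      ring

theorem tendsto_of_X_pow_dvd {f : ℕ → ℤ⟦X⟧} {a : ℤ⟦X⟧} (h : ∀ n, X ^ n ∣ f n - a) :
    Filter.Tendsto f Filter.atTop (nhds a) := by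
  rw [WithPiTopology.tendsto_iff_coeff_tendsto]
  intro d
  refine tendsto_atTop_of_eventually_const (i₀ := d + 1) fun i hi => ?_
  have := X_pow_dvd_iff.mp (h i) d (by omega)
  rw [map_sub] at this
  linarith

theorem qPoch_tendsto (b : ℤ⟦X⟧) {q : ℤ⟦X⟧} (hq : X ∣ q) :
    Filter.Tendsto (qPoch b q) Filter.atTop (nhds (qPochInf b q)) :=
  (multipliable_qPochInf b hq).hasProd.tendsto_prod_nat

/-- A function of `z` with `F z = (1 - z) F (z q)` and `F 0 = 1` is `(z; q)_∞`. -/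
theorem eq_qPochInf {F : ℤ⟦X⟧ → ℤ⟦X⟧} {q : ℤ⟦X⟧} (hq : X ∣ q)
    (hF : ∀ z, X ∣ z → F z = (1 - z) * F (z * q)) (h0 : ∀ n z, X ^ (n + 1) ∣ z → X ^ n ∣ F z - 1)
    {z : ℤ⟦X⟧} (hz : X ∣ z) : F z = qPochInf z q := by
  -- Iterating the functional equation moves the argument to $zq^n\to 0$, where $F\to 1$.
  have key : ∀ n, F z = qPoch z q n * F (z * q ^ n) := by
    intro n
    induction n with
    | zero => simp [qPoch]
    | succ n ih =>
      rw [ih, hF _ (hz.mul_right _), qPoch_succ]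
      ring_nf
  have h1 : Filter.Tendsto (fun n => F (z * q ^ n)) Filter.atTop (nhds 1) :=
    tendsto_of_X_pow_dvd fun n => h0 n _ (by
      rw [pow_succ']; exact mul_dvd_mul hz (pow_dvd_pow_of_dvd hq n))
  have h2 := (qPoch_tendsto z hq).mul h1
  rw [mul_one] at h2
  exact tendsto_nhds_unique (tendsto_const_nhds.congr key) h2

theorem X_pow_dvd_tsum {ι : Type*} {f : ι → ℤ⟦X⟧} (hf : Summable f) {n : ℕ}
    (h : ∀ i, X ^ n ∣ f i) : X ^ n ∣ ∑' i, f i := by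
  rw [X_pow_dvd_iff]
  intro m hm
  have := ((WithPiTopology.hasSum_iff_hasSum_coeff ℤ).mp hf.hasSum m).tsum_eq
  rw [← this]
  simp [fun i => X_pow_dvd_iff.mp (h i) m hm]

/-! ### Euler's two expansions -/

/-- `1 / (q; q)_j`. -/
def qFactInv (q : ℤ⟦X⟧) (j : ℕ) : ℤ⟦X⟧ := invOfUnit (qPoch q q j) 1

theorem qPoch_mul_qFactInv {q : ℤ⟦X⟧} (hq : X ∣ q) (j : ℕ) : qPoch q q j * qFactInv q j = 1 :=
  mul_invOfUnit _ _ (by simp [constantCoeff_qPoch hq])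

@[simp] theorem qFactInv_zero {q : ℤ⟦X⟧} (hq : X ∣ q) : qFactInv q 0 = 1 := by
  simpa [qPoch] using qPoch_mul_qFactInv hq 0

theorem qPoch_ne_zero {b : ℤ⟦X⟧} (hb : X ∣ b) (q : ℤ⟦X⟧) (n : ℕ) : qPoch b q n ≠ 0 := by
  intro h
  simpa [h] using constantCoeff_qPoch hb q n

theorem one_sub_pow_mul_qFactInv {q : ℤ⟦X⟧} (hq : X ∣ q) (j : ℕ) :
    (1 - q ^ (j + 1)) * qFactInv q (j + 1) = qFactInv q j := by
  apply mul_left_cancel₀ (qPoch_ne_zero hq q j)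
  rw [qPoch_mul_qFactInv hq, pow_succ', ← mul_assoc, ← qPoch_succ, qPoch_mul_qFactInv hq]

theorem summable_nat_of_X_pow_dvd {f : ℕ → ℤ⟦X⟧} (hf : ∀ i, X ^ i ∣ f i) : Summable f :=
  summable_of_X_pow_dvd id hf fun n => Set.finite_Iic n

theorem summable_euler {z : ℤ⟦X⟧} (hz : X ∣ z) (c : ℕ → ℤ⟦X⟧) :
    Summable fun j : ℕ => c j * z ^ j :=
  summable_nat_of_X_pow_dvd fun i => (pow_dvd_pow_of_dvd hz i).mul_left _

theorem X_pow_dvd_tsum_euler_sub_one {z : ℤ⟦X⟧} {c : ℕ → ℤ⟦X⟧} (hc : c 0 = 1) {n : ℕ}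
    (hz : X ^ (n + 1) ∣ z) : X ^ n ∣ ∑' j, c j * z ^ j - 1 := by
  have hz1 : X ∣ z := (dvd_pow_self X n.succ_ne_zero).trans hz
  rw [(summable_euler hz1 c).tsum_eq_zero_add]
  simp only [hc, pow_zero, mul_one, add_sub_cancel_left]
  refine X_pow_dvd_tsum ((summable_nat_add_iff 1).mpr (summable_euler hz1 c)) fun i => ?_
  rw [pow_succ]
  exact (((pow_dvd_pow X n.le_succ).trans hz).mul_left _).mul_left _

/-- Euler: `∑ (-1)^j q^{j(j-1)/2} z^j / (q; q)_j = (z; q)_∞`. -/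
theorem tsum_euler {q z : ℤ⟦X⟧} (hq : X ∣ q) (hz : X ∣ z) :
    ∑' j : ℕ, ((-1) ^ j * q ^ (j.choose 2) * qFactInv q j) * z ^ j = qPochInf z q := by
  refine eq_qPochInf (F := fun z => ∑' j : ℕ, ((-1) ^ j * q ^ (j.choose 2) * qFactInv q j) * z ^ j)
    hq ?_ (fun n z h => X_pow_dvd_tsum_euler_sub_one (by simp [hq]) h) hz
  intro z hz
  have hS := summable_euler hz fun j => (-1) ^ j * q ^ (j.choose 2) * qFactInv q j
  have hS' := summable_euler (hz.mul_right q) fun j =>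
    (-1) ^ j * q ^ (j.choose 2) * qFactInv q j
  rw [sub_mul, one_mul, ← hS'.tsum_mul_left, eq_sub_iff_add_eq, ← eq_sub_iff_add_eq', ← hS'.tsum_sub hS,
    (hS'.sub hS).tsum_eq_zero_add]
  simp only [pow_zero, sub_self, zero_add]
  refine tsum_congr fun j => ?_
  rw [← one_sub_pow_mul_qFactInv hq j, Nat.choose_succ_succ' j 1, Nat.choose_one_right]
  ring

/-- Euler: `∑ z^j / (q; q)_j = 1 / (z; q)_∞`. -/
theorem tsum_euler_inv {q z : ℤ⟦X⟧} (hq : X ∣ q) (hz : X ∣ z) :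
    (∑' j : ℕ, qFactInv q j * z ^ j) * qPochInf z q = 1 := by
  set F : ℤ⟦X⟧ → ℤ⟦X⟧ := fun z => ∑' j : ℕ, qFactInv q j * z ^ j with hFdef
  have hF : ∀ z, X ∣ z → F (z * q) = (1 - z) * F z := by
    intro z hz
    have hS := summable_euler hz fun j => qFactInv q j
    have hS' := summable_euler (hz.mul_right q) fun j => qFactInv q j
    simp only [hFdef]
    rw [sub_mul, one_mul, ← hS.tsum_mul_left, eq_sub_iff_add_eq, ← eq_sub_iff_add_eq', ← hS.tsum_sub hS',
      (hS.sub hS').tsum_eq_zero_add]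
    simp only [pow_zero, sub_self, zero_add]
    refine tsum_congr fun j => ?_
    rw [← one_sub_pow_mul_qFactInv hq j]
    ring
  have key : ∀ n, F (z * q ^ n) = qPoch z q n * F z := by
    intro n
    induction n with
    | zero => simp [qPoch]
    | succ n ih =>
      rw [pow_succ, ← mul_assoc, hF _ (hz.mul_right _), ih, qPoch_succ]
      ring
  have h1 : Filter.Tendsto (fun n => F (z * q ^ n)) Filter.atTop (nhds 1) :=
    tendsto_of_X_pow_dvd fun n => X_pow_dvd_tsum_euler_sub_one (qFactInv_zero hq) (by
      rw [pow_succ']; exact mul_dvd_mul hz (pow_dvd_pow_of_dvd hq n))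
  have h2 := (qPoch_tendsto z hq).mul_const (F z)
  rw [mul_comm]
  exact tendsto_nhds_unique h2 (h1.congr key)

/-! ### The Jacobi triple product -/

theorem two_mul_toNat_triangular (m : ℤ) : 2 * ((m * (m + 1) / 2).toNat : ℤ) = m * (m + 1) := by
  have h : Even (m * (m + 1)) := Int.even_mul_succ_self m
  have h0 : 0 ≤ m * (m + 1) := by
    rcases le_or_gt 0 m with h | h <;> nlinarith
  obtain ⟨k, hk⟩ := h
  omega

/-- The summand `u^{m(m+1)/2} w^{m(m-1)/2}` of Ramanujan's theta function. -/
def thetaTerm (u w : ℤ⟦X⟧) (m : ℤ) : ℤ⟦X⟧ :=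
  u ^ (m * (m + 1) / 2).toNat * w ^ (m * (m - 1) / 2).toNat

theorem two_mul_toNat_triangular' (m : ℤ) : 2 * ((m * (m - 1) / 2).toNat : ℤ) = m * (m - 1) := by
  have := two_mul_toNat_triangular (m - 1)
  rw [sub_add_cancel, mul_comm (m - 1)] at this
  exact this

theorem X_pow_dvd_thetaTerm {u w : ℤ⟦X⟧} (hu : X ∣ u) (hw : X ∣ w) (m : ℤ) :
    X ^ (m.natAbs ^ 2) ∣ thetaTerm u w m := by
  have h : m.natAbs ^ 2 = (m * (m + 1) / 2).toNat + (m * (m - 1) / 2).toNat := by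
    zify
    rw [sq_abs]
    linarith [two_mul_toNat_triangular m, two_mul_toNat_triangular' m]
  rw [h, pow_add]
  exact mul_dvd_mul (pow_dvd_pow_of_dvd hu _) (pow_dvd_pow_of_dvd hw _)

theorem finite_natAbs_sq_le (n : ℕ) : {m : ℤ | m.natAbs ^ 2 ≤ n}.Finite := by
  refine (Set.finite_Icc (-(n : ℤ)) n).subset fun m hm => ?_
  have : m.natAbs ≤ n := (Nat.le_self_pow two_ne_zero _).trans hm
  constructor <;> omega

theorem summable_thetaTerm {u w : ℤ⟦X⟧} (hu : X ∣ u) (hw : X ∣ w) : Summable (thetaTerm u w) :=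
  summable_of_X_pow_dvd _ (X_pow_dvd_thetaTerm hu hw) finite_natAbs_sq_le

theorem thetaTerm_succ (u w : ℤ⟦X⟧) (k j : ℕ) :
    thetaTerm u w (-(k : ℤ) - 1 + j) * (u * w) ^ j =
      thetaTerm u w (-(k : ℤ) + j) * (u ^ k * w ^ (k + 1)) := by
  have e1 : ((-(k : ℤ) - 1 + j) * ((-(k : ℤ) - 1 + j) + 1) / 2).toNat + j =
      ((-(k : ℤ) + j) * ((-(k : ℤ) + j) + 1) / 2).toNat + k := by
    have h1 := two_mul_toNat_triangular (-(k : ℤ) - 1 + j)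
    have h2 := two_mul_toNat_triangular (-(k : ℤ) + j)
    zify
    nlinarith
  have e2 : ((-(k : ℤ) - 1 + j) * ((-(k : ℤ) - 1 + j) - 1) / 2).toNat + j =
      ((-(k : ℤ) + j) * ((-(k : ℤ) + j) - 1) / 2).toNat + (k + 1) := by
    have h1 := two_mul_toNat_triangular' (-(k : ℤ) - 1 + j)
    have h2 := two_mul_toNat_triangular' (-(k : ℤ) + j)
    zify
    nlinarith
  unfold thetaTerm
  rw [mul_pow]
  calc _ = u ^ (((-(k : ℤ) - 1 + j) * ((-(k : ℤ) - 1 + j) + 1) / 2).toNat + j) *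
        w ^ (((-(k : ℤ) - 1 + j) * ((-(k : ℤ) - 1 + j) - 1) / 2).toNat + j) := by
          rw [pow_add, pow_add]; ring
    _ = _ := by rw [e1, e2, pow_add, pow_add]; ring

theorem two_mul_choose_two (j : ℕ) : 2 * (j.choose 2 : ℤ) = j * (j - 1) := by
  induction j with
  | zero => simp
  | succ j ih => rw [Nat.choose_succ_succ' j 1, Nat.choose_one_right]; push_cast; linarith

theorem thetaTerm_natCast (u w : ℤ⟦X⟧) (n : ℕ) :
    thetaTerm u w n = (u * w) ^ n.choose 2 * u ^ n := by
  have e1 : ((n : ℤ) * (n + 1) / 2).toNat = n.choose 2 + n := by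
    have h1 := two_mul_toNat_triangular n
    have h2 := two_mul_choose_two n
    zify
    nlinarith
  have e2 : ((n : ℤ) * (n - 1) / 2).toNat = n.choose 2 := by
    have h1 := two_mul_toNat_triangular' n
    have h2 := two_mul_choose_two n
    zify
    nlinarith
  rw [thetaTerm, e1, e2]
  ring

theorem thetaTerm_natCast_add (u w : ℤ⟦X⟧) (n j : ℕ) :
    thetaTerm u w (n + j) * w ^ j =
      thetaTerm u w n * ((u * w) ^ j.choose 2 * ((u * w) ^ (n + 1)) ^ j) := by
  have h : (n + j).choose 2 + j = n.choose 2 + j.choose 2 + (n + 1) * j := by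
    have h1 := two_mul_choose_two (n + j)
    have h2 := two_mul_choose_two n
    have h3 := two_mul_choose_two j
    zify
    push_cast at h1
    nlinarith
  rw [← Nat.cast_add, thetaTerm_natCast, thetaTerm_natCast]
  calc _ = (u * w) ^ ((n + j).choose 2 + j) * u ^ n := by rw [pow_add, pow_add, mul_pow _ _ j]; ring
    _ = _ := by rw [h, pow_add, pow_add, pow_mul]; ring

section TripleProduct

variable {u w : ℤ⟦X⟧}

theorem X_pow_dvd_thetaTerm_mul_pow (hu : X ∣ u) (hw : X ∣ w) (c : ℤ × ℕ → ℤ⟦X⟧) (p : ℤ × ℕ) :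
    X ^ (p.1.natAbs ^ 2 + p.2) ∣ thetaTerm u w p.1 * (c p * w ^ p.2) := by
  rw [pow_add]
  exact mul_dvd_mul (X_pow_dvd_thetaTerm hu hw _) ((pow_dvd_pow_of_dvd hw _).mul_left _)

theorem summable_thetaTerm_prod (hu : X ∣ u) (hw : X ∣ w) (c : ℤ × ℕ → ℤ⟦X⟧) :
    Summable fun p : ℤ × ℕ => thetaTerm u w p.1 * (c p * w ^ p.2) := by
  refine summable_of_X_pow_dvd _ (X_pow_dvd_thetaTerm_mul_pow hu hw c) fun n => ?_
  refine ((finite_natAbs_sq_le n).prod (Set.finite_Iic n)).subset fun p hp => ?_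
  simp only [Set.mem_ofPred_eq] at hp
  exact ⟨by simp only [Set.mem_ofPred_eq]; omega, by simp only [Set.mem_Iic]; omega⟩

/-- The sum `∑_j (-1)^j u^{T(n+j)} w^{T(n+j-1)} w^j / (uw; uw)_j`, with `T(m) = m(m+1)/2`. -/
def tripleAux (u w : ℤ⟦X⟧) (n : ℤ) : ℤ⟦X⟧ :=
  ∑' j : ℕ, thetaTerm u w (n + j) * ((-1) ^ j * qFactInv (u * w) j * w ^ j)

theorem summable_tripleAux (hw : X ∣ w) (n : ℤ) (c : ℕ → ℤ⟦X⟧) :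
    Summable fun j : ℕ => thetaTerm u w (n + j) * (c j * w ^ j) :=
  summable_nat_of_X_pow_dvd fun _ => ((pow_dvd_pow_of_dvd hw _).mul_left _).mul_left _

/-- Split $1=q^j+(1-q^j)$ with $q=uw$: the first part is matched by `thetaTerm_succ`, and in the
second the factor cancels against $1/(q;q)_j$, so that $j$ shifts by one. -/
theorem tripleAux_neg_succ (hu : X ∣ u) (hw : X ∣ w) (k : ℕ) :
    tripleAux u w (-(k : ℤ) - 1) = (u ^ k * w ^ (k + 1) - w) * tripleAux u w (-k) := by
  have hq : X ∣ u * w := hu.mul_right w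
  have h1 : ∀ j : ℕ, thetaTerm u w (-(k : ℤ) - 1 + j) *
      ((-1) ^ j * qFactInv (u * w) j * w ^ j) =
      u ^ k * w ^ (k + 1) * (thetaTerm u w (-(k : ℤ) + j) *
        ((-1) ^ j * qFactInv (u * w) j * w ^ j)) +
      thetaTerm u w (-(k : ℤ) - 1 + j) *
        (((-1) ^ j * ((1 - (u * w) ^ j) * qFactInv (u * w) j)) * w ^ j) := by
    intro j
    linear_combination ((-1) ^ j * qFactInv (u * w) j * w ^ j) * thetaTerm_succ u w k j
  have hs := summable_tripleAux (u := u) hw (-(k : ℤ)) fun j => (-1) ^ j * qFactInv (u * w) j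
  have hs' := summable_tripleAux (u := u) hw (-(k : ℤ) - 1) fun j =>
    (-1) ^ j * ((1 - (u * w) ^ j) * qFactInv (u * w) j)
  rw [tripleAux, tsum_congr h1, (hs.mul_left _).tsum_add hs', hs.tsum_mul_left,
    hs'.tsum_eq_zero_add]
  simp only [one_sub_pow_mul_qFactInv hq]
  have h2 : ∀ j : ℕ, thetaTerm u w (-(k : ℤ) - 1 + ((j + 1 : ℕ) : ℤ)) *
      ((-1) ^ (j + 1) * qFactInv (u * w) j * w ^ (j + 1)) =
      (-w) * (thetaTerm u w (-(k : ℤ) + j) * ((-1) ^ j * qFactInv (u * w) j * w ^ j)) := by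
    intro j
    rw [show -(k : ℤ) - 1 + ((j + 1 : ℕ) : ℤ) = -k + j by push_cast; ring]
    ring
  rw [tsum_congr h2, hs.tsum_mul_left, ← tripleAux]
  ring

/-- The factor $u^kw^{k+1}-w$ of the recurrence vanishes at $k=0$, and the zero propagates. -/
theorem tripleAux_of_neg (hu : X ∣ u) (hw : X ∣ w) (k : ℕ) :
    tripleAux u w (-(k : ℤ) - 1) = 0 := by
  induction k with
  | zero => rw [tripleAux_neg_succ hu hw]; simp
  | succ k ih =>
    rw [tripleAux_neg_succ hu hw, show -((k + 1 : ℕ) : ℤ) = -k - 1 by push_cast; ring, ih, mul_zero]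

/-- Completing the exponents leaves Euler's series at $z=q^{n+1}$, whose value is
$(q;q)_\infty/(q;q)_n$; the right side is a term of Euler's series for $(-u;q)_\infty$. -/
theorem tripleAux_natCast (hu : X ∣ u) (n : ℕ) :
    tripleAux u w n = qPochInf (u * w) (u * w) *
      ((-1) ^ n * (u * w) ^ n.choose 2 * qFactInv (u * w) n * (-u) ^ n) := by
  have hq : X ∣ u * w := hu.mul_right w
  have hqn : X ∣ (u * w) ^ (n + 1) := hq.trans (dvd_pow_self _ n.succ_ne_zero)
  have h1 : ∀ j : ℕ, thetaTerm u w (n + j) * ((-1) ^ j * qFactInv (u * w) j * w ^ j) =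
      thetaTerm u w n * ((-1) ^ j * (u * w) ^ j.choose 2 * qFactInv (u * w) j *
        ((u * w) ^ (n + 1)) ^ j) := by
    intro j
    linear_combination ((-1) ^ j * qFactInv (u * w) j) * thetaTerm_natCast_add u w n j
  rw [tripleAux, tsum_congr h1, (summable_euler hqn _).tsum_mul_left, tsum_euler hq hqn,
    thetaTerm_natCast, qPochInf_eq_mul (u * w) hq n, ← pow_succ']
  have h := qPoch_mul_qFactInv hq n
  have h2 : (-1 : ℤ⟦X⟧) ^ n * (-u) ^ n = u ^ n := by rw [← mul_pow]; ring
  linear_combination (-(u * w) ^ n.choose 2 * u ^ n * qPochInf ((u * w) ^ (n + 1)) (u * w)) * h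
    - (qPoch (u * w) (u * w) n * qPochInf ((u * w) ^ (n + 1)) (u * w) * (u * w) ^ n.choose 2 *
      qFactInv (u * w) n) * h2

/-- The Jacobi triple product identity. -/
theorem theta_eq_qPochInf (hu : X ∣ u) (hw : X ∣ w) :
    theta u w = qPochInf (-u) (u * w) * qPochInf (-w) (u * w) * qPochInf (u * w) (u * w) := by
  have hq : X ∣ u * w := hu.mul_right w
  have hS := summable_thetaTerm_prod hu hw fun p => (-1) ^ p.2 * qFactInv (u * w) p.2
  -- The double sum is $\theta(u,w)/(-w;uw)_\infty$; shearing $n\mapsto n+j$ makes `tripleAux` its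
  -- inner sum.
  let e : ℤ × ℕ ≃ ℤ × ℕ :=
    { toFun := fun p => (p.1 + p.2, p.2)
      invFun := fun p => (p.1 - p.2, p.2)
      left_inv := fun p => by simp
      right_inv := fun p => by simp }
  have hS' := (e.summable_iff).mpr hS
  have h1 : ∑' p : ℤ × ℕ, thetaTerm u w p.1 * ((-1) ^ p.2 * qFactInv (u * w) p.2 * w ^ p.2) =
      ∑' n : ℤ, tripleAux u w n := by
    rw [← e.tsum_eq]
    exact Summable.tsum_prod' hS' fun n => summable_tripleAux hw n _
  have h2 : ∑' p : ℤ × ℕ, thetaTerm u w p.1 * ((-1) ^ p.2 * qFactInv (u * w) p.2 * w ^ p.2) =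
      theta u w * ∑' j : ℕ, qFactInv (u * w) j * (-w) ^ j := by
    have hE := summable_euler (hw.neg_right) fun j => qFactInv (u * w) j
    rw [Summable.tsum_prod' hS fun n => ?_]
    · have hθ : theta u w = ∑' n, thetaTerm u w n := rfl
      rw [hθ, ← (summable_thetaTerm hu hw).tsum_mul_right]
      refine tsum_congr fun n => ?_
      dsimp only
      rw [← hE.tsum_mul_left]
      refine tsum_congr fun j => ?_
      rw [neg_pow w j]; ring
    · have := hE.mul_left (thetaTerm u w n)
      refine this.congr fun j => ?_
      rw [neg_pow w j]; ring
  have h3 : ∑' n : ℤ, tripleAux u w n = qPochInf (u * w) (u * w) * qPochInf (-u) (u * w) := by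
    have hE := summable_euler (hu.neg_right) fun j =>
      (-1) ^ j * (u * w) ^ j.choose 2 * qFactInv (u * w) j
    rw [← tsum_euler hq hu.neg_right, ← hE.tsum_mul_left]
    have hinj : Function.Injective ((↑) : ℕ → ℤ) := Nat.cast_injective
    rw [← hinj.tsum_eq]
    · exact tsum_congr fun n => tripleAux_natCast hu n
    · intro n hn
      by_contra hneg
      apply hn
      obtain ⟨k, rfl⟩ : ∃ k : ℕ, n = -(k : ℤ) - 1 := by
        refine ⟨(-n - 1).toNat, ?_⟩
        have : ¬ 0 ≤ n := fun h => hneg ⟨n.toNat, Int.toNat_of_nonneg h⟩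
        omega
      exact tripleAux_of_neg hu hw k
  have h4 := tsum_euler_inv hq hw.neg_right
  linear_combination qPochInf (-w) (u * w) * (h2.symm.trans (h1.trans h3)) -
    theta u w * h4

end TripleProduct

/-! ### Product formulas for the theta functions -/

theorem qPochInf_mul_neg (b : ℤ⟦X⟧) {q : ℤ⟦X⟧} (hq : X ∣ q) :
    qPochInf b q * qPochInf (-b) q = qPochInf (b ^ 2) (q ^ 2) := by
  rw [qPochInf, qPochInf, ← (multipliable_qPochInf b hq).tprod_mul (multipliable_qPochInf (-b) hq)]
  exact tprod_congr fun k => by ring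

theorem qPochInf_even_mul_odd (b : ℤ⟦X⟧) {q : ℤ⟦X⟧} (hq : X ∣ q) :
    qPochInf b (q ^ 2) * qPochInf (b * q) (q ^ 2) = qPochInf b q := by
  have hq2 : X ∣ q ^ 2 := hq.trans (dvd_pow_self q two_ne_zero)
  have h := tprod_even_mul_odd (f := fun k : ℕ => 1 - b * q ^ k)
    ((multipliable_qPochInf b hq2).congr fun k => by ring)
    ((multipliable_qPochInf (b * q) hq2).congr fun k => by ring)
  rw [qPochInf, qPochInf, qPochInf, ← h]
  congr 1
  · exact tprod_congr fun k => by ring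
  · exact tprod_congr fun k => by ring

theorem qPochInf_ne_zero {b q : ℤ⟦X⟧} (hb : X ∣ b) (hq : X ∣ q) : qPochInf b q ≠ 0 := fun h => by
  have := tsum_euler_inv hq hb
  rw [h, mul_zero] at this
  exact zero_ne_one this

theorem psi_mul_qPochInf {q : ℤ⟦X⟧} (hq : X ∣ q) :
    psi q * qPochInf q (q ^ 2) = qPochInf (q ^ 2) (q ^ 2) := by
  have hq2 : X ∣ q ^ 2 := hq.trans (dvd_pow_self q two_ne_zero)
  have hq3 : X ∣ q ^ 3 := hq.trans (dvd_pow_self q three_ne_zero)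
  have h1 := theta_eq_qPochInf hq hq3
  have h2 := qPochInf_even_mul_odd (-q) hq2
  have h3 := qPochInf_mul_neg q hq2
  have h4 := qPochInf_even_mul_odd (q ^ 2) hq2
  rw [show -q * q ^ 2 = -q ^ 3 by ring] at h2
  rw [show q * q ^ 3 = (q ^ 2) ^ 2 by ring, h2] at h1
  rw [show q ^ 2 * q ^ 2 = (q ^ 2) ^ 2 by ring] at h4
  rw [psi, h1, ← h4, ← h3]
  ring

theorem theta_neg_neg {q : ℤ⟦X⟧} (hq : X ∣ q) :
    theta (-q) (-q) = qPochInf q (q ^ 2) ^ 2 * qPochInf (q ^ 2) (q ^ 2) := by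
  rw [theta_eq_qPochInf hq.neg_right hq.neg_right, neg_neg, neg_mul_neg, ← sq, ← sq]

/-- Euler's equality of partitions into distinct parts and into odd parts. -/
theorem qPochInf_neg_mul_odd {q : ℤ⟦X⟧} (hq : X ∣ q) :
    qPochInf (-q) q * qPochInf q (q ^ 2) = 1 := by
  have hq2 : X ∣ q ^ 2 := hq.trans (dvd_pow_self q two_ne_zero)
  have h1 := qPochInf_mul_neg q hq
  have h2 := qPochInf_even_mul_odd q hq
  rw [← sq] at h2
  apply mul_right_cancel₀ (qPochInf_ne_zero hq2 hq2)
  linear_combination qPochInf (-q) q * h2 + h1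

/-! ### The alternating convolution -/

/-- `∑_{j+k=N} (-1)^j / ((q; q)_j (q; q)_k)`. -/
def altConv (q : ℤ⟦X⟧) (N : ℕ) : ℤ⟦X⟧ :=
  ∑ p ∈ Finset.HasAntidiagonal.antidiagonal N, (-1) ^ p.1 * qFactInv q p.1 * qFactInv q p.2

/-- `altConv q N` is the coefficient of $z^N$ in $1/((z;q)_\infty(-z;q)_\infty)=1/(z^2;q^2)_\infty$.
The recurrence telescopes $1-q^{j+k}=(1-q^j)+q^j(1-q^k)$, using the auxiliary sum `d` weighted by
$q^j$. -/
theorem altConv_add_two {q : ℤ⟦X⟧} (hq : X ∣ q) (N : ℕ) :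
    (1 - q ^ (N + 2)) * altConv q (N + 2) = altConv q N := by
  let d : ℕ → ℤ⟦X⟧ := fun N =>
    ∑ p ∈ Finset.HasAntidiagonal.antidiagonal N, (-1) ^ p.1 * q ^ p.1 * qFactInv q p.1 * qFactInv q p.2
  have h1 : ∀ N, altConv q (N + 1) - d (N + 1) = - altConv q N := by
    intro N
    simp only [altConv, d]
    rw [← Finset.sum_sub_distrib, Finset.Nat.sum_antidiagonal_succ, ← Finset.sum_neg_distrib]
    simp only [pow_zero, one_mul, sub_self, zero_add]
    refine Finset.sum_congr rfl fun p _ => ?_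
    rw [← one_sub_pow_mul_qFactInv hq p.1]
    ring
  have h2 : ∀ N, d (N + 1) - q ^ (N + 1) * altConv q (N + 1) = d N := by
    intro N
    simp only [altConv, d]
    rw [Finset.mul_sum, ← Finset.sum_sub_distrib, Finset.Nat.sum_antidiagonal_succ']
    rw [show ∀ a b c d : ℤ⟦X⟧, a * b * c * d - b * (a * c * d) = 0 by intros; ring, zero_add]
    refine Finset.sum_congr rfl fun p hp => ?_
    rw [← one_sub_pow_mul_qFactInv hq p.2, ← Finset.HasAntidiagonal.mem_antidiagonal.mp hp]
    ring
  linear_combination h1 (N + 1) + h2 (N + 1) - h1 N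

theorem one_sub_pow_ne_zero {q : ℤ⟦X⟧} (hq : X ∣ q) {n : ℕ} (hn : n ≠ 0) : 1 - q ^ n ≠ 0 := by
  intro h
  have := congrArg constantCoeff h
  simp [X_dvd_iff.mp hq, hn] at this

theorem altConv_odd {q : ℤ⟦X⟧} (hq : X ∣ q) (M : ℕ) : altConv q (2 * M + 1) = 0 := by
  induction M with
  | zero => simp [altConv, Finset.Nat.antidiagonal_succ, mul_comm]
  | succ M ih =>
    apply mul_left_cancel₀ (one_sub_pow_ne_zero hq (n := 2 * M + 1 + 2) (by omega))
    rw [show 2 * (M + 1) + 1 = 2 * M + 1 + 2 by ring, altConv_add_two hq, ih, mul_zero]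

theorem altConv_even {q : ℤ⟦X⟧} (hq : X ∣ q) (M : ℕ) :
    altConv q (2 * M) = qFactInv (q ^ 2) M := by
  have hq2 : X ∣ q ^ 2 := hq.trans (dvd_pow_self q two_ne_zero)
  induction M with
  | zero => simp [altConv, hq, hq2]
  | succ M ih =>
    apply mul_left_cancel₀ (one_sub_pow_ne_zero hq (n := 2 * M + 2) (by omega))
    rw [show 2 * (M + 1) = 2 * M + 2 by ring, altConv_add_two hq, ih,
      ← one_sub_pow_mul_qFactInv hq2]
    ring

/-! ### A bilateral series for $v(q)-v(-q)$ -/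

/-- The sum `∑_j s^j X^{(j-ν)^2} / (X²; X²)_j`. -/
def sqSum (s : ℤ⟦X⟧) (ν : ℤ) : ℤ⟦X⟧ :=
  ∑' j : ℕ, s ^ j * X ^ ((j - ν).natAbs ^ 2) * qFactInv (X ^ 2) j

theorem finite_natAbs_sub_sq_le (ν : ℤ) (n : ℕ) :
    {j : ℕ | ((j : ℤ) - ν).natAbs ^ 2 ≤ n}.Finite := by
  have := (finite_natAbs_sq_le n).preimage (f := fun j : ℕ => (j : ℤ) - ν)
    (fun a _ b _ h => by simpa using h)
  exact this

theorem summable_sqSum (ν : ℤ) (c : ℕ → ℤ⟦X⟧) :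
    Summable fun j : ℕ => c j * X ^ (((j : ℤ) - ν).natAbs ^ 2) * qFactInv (X ^ 2) j :=
  summable_of_X_pow_dvd _ (fun _ => Dvd.intro_left _ rfl |>.mul_right _) (finite_natAbs_sub_sq_le ν)

theorem X_dvd_X_sq : (X : ℤ⟦X⟧) ∣ X ^ 2 := dvd_pow_self X two_ne_zero

theorem tsum_sqSum_aux (s : ℤ⟦X⟧) (ν : ℤ) :
    ∑' j : ℕ, s ^ j * (1 - (X ^ 2) ^ j) * X ^ (((j : ℤ) - ν).natAbs ^ 2) * qFactInv (X ^ 2) j =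
      s * sqSum s (ν - 1) := by
  rw [(summable_sqSum ν _).tsum_eq_zero_add, sqSum, ← (summable_sqSum (ν - 1) _).tsum_mul_left]
  simp only [pow_zero, sub_self, mul_zero, zero_mul, zero_add]
  refine tsum_congr fun j => ?_
  rw [← one_sub_pow_mul_qFactInv X_dvd_X_sq j,
    show ((j + 1 : ℕ) : ℤ) - ν = j - (ν - 1) by push_cast; ring]
  ring

/-- Split $1=(1-q^{2j})+q^{2j}$: the first part shifts $j$, and the second uses
$(j-a-1)^2+2j=(j-a)^2+2a+1$. -/
theorem sqSum_succ (s : ℤ⟦X⟧) (a : ℕ) :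
    sqSum s (a + 1) = (s + X ^ (2 * a + 1)) * sqSum s a := by
  have h := tsum_sqSum_aux s (a + 1)
  rw [add_sub_cancel_right] at h
  have h1 : ∀ j : ℕ, s ^ j * X ^ (((j : ℤ) - (a + 1)).natAbs ^ 2) * qFactInv (X ^ 2) j =
      s ^ j * (1 - (X ^ 2) ^ j) * X ^ (((j : ℤ) - (a + 1)).natAbs ^ 2) * qFactInv (X ^ 2) j +
      X ^ (2 * a + 1) * (s ^ j * X ^ (((j : ℤ) - a).natAbs ^ 2) * qFactInv (X ^ 2) j) := by
    intro j
    have e : ((j : ℤ) - (a + 1)).natAbs ^ 2 + 2 * j = ((j : ℤ) - a).natAbs ^ 2 + (2 * a + 1) := by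
      zify
      rw [sq_abs, sq_abs]; ring
    have e' := congrArg (fun n => (X : ℤ⟦X⟧) ^ n) e
    simp only [pow_add _ _ (2 * j), pow_mul, pow_add _ _ (2 * a + 1)] at e'
    linear_combination s ^ j * qFactInv (X ^ 2) j * e'
  rw [sqSum, tsum_congr h1, (summable_sqSum _ _).tsum_add ((summable_sqSum _ _).mul_left _), h,
    (summable_sqSum _ _).tsum_mul_left, ← sqSum]
  ring

theorem sqSum_neg (s : ℤ⟦X⟧) (a : ℕ) :
    X ^ (2 * a + 1) * sqSum s (-(a : ℤ)) = (1 + s * X ^ (2 * a + 1)) * sqSum s (-(a : ℤ) - 1) := by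
  have h := tsum_sqSum_aux s (-(a : ℤ))
  have h1 : ∀ j : ℕ, X ^ (2 * a + 1) *
      (s ^ j * X ^ (((j : ℤ) - -(a : ℤ)).natAbs ^ 2) * qFactInv (X ^ 2) j) =
      X ^ (2 * a + 1) * (s ^ j * (1 - (X ^ 2) ^ j) * X ^ (((j : ℤ) - -(a : ℤ)).natAbs ^ 2) *
        qFactInv (X ^ 2) j) +
      s ^ j * X ^ (((j : ℤ) - (-(a : ℤ) - 1)).natAbs ^ 2) * qFactInv (X ^ 2) j := by
    intro j
    have e : ((j : ℤ) - -(a : ℤ)).natAbs ^ 2 + (2 * a + 1) + 2 * j =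
        ((j : ℤ) - (-(a : ℤ) - 1)).natAbs ^ 2 := by
      zify
      rw [sq_abs, sq_abs]; ring
    rw [← e, pow_add, pow_add, pow_mul X 2 j]
    ring
  rw [sqSum, ← (summable_sqSum _ _).tsum_mul_left, tsum_congr h1,
    ((summable_sqSum _ _).mul_left _).tsum_add (summable_sqSum _ _),
    (summable_sqSum _ _).tsum_mul_left, h, ← sqSum]
  ring

theorem sqSum_natCast {s : ℤ⟦X⟧} (hs : s * s = 1) (a : ℕ) :
    sqSum s a = s ^ a * qPoch (-s * X) (X ^ 2) a * sqSum s 0 := by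
  induction a with
  | zero => simp [qPoch]
  | succ a ih =>
    push_cast
    rw [sqSum_succ, ih, qPoch_succ]
    linear_combination (-X ^ (2 * a + 1) * s ^ a * qPoch (-s * X) (X ^ 2) a * sqSum s 0) * hs

theorem sqSum_neg_natCast (s : ℤ⟦X⟧) (a : ℕ) :
    sqSum s (-(a : ℤ)) * qPoch (-s * X) (X ^ 2) a = X ^ (a ^ 2) * sqSum s 0 := by
  induction a with
  | zero => simp [qPoch]
  | succ a ih =>
    have h := sqSum_neg s a
    rw [qPoch_succ, show -((a + 1 : ℕ) : ℤ) = -a - 1 by push_cast; ring]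
    calc _ = (1 + s * X ^ (2 * a + 1)) * sqSum s (-(a : ℤ) - 1) * qPoch (-s * X) (X ^ 2) a := by ring
      _ = X ^ (2 * a + 1) * (sqSum s (-(a : ℤ)) * qPoch (-s * X) (X ^ 2) a) := by rw [← h]; ring
      _ = _ := by rw [ih]; ring

theorem sqSum_zero (s : ℤ⟦X⟧) : sqSum s 0 = qPochInf (-s * X) (X ^ 2) := by
  rw [← tsum_euler X_dvd_X_sq (Dvd.intro_left _ rfl), sqSum]
  refine tsum_congr fun j => ?_
  have e : ((j : ℤ) - 0).natAbs ^ 2 = 2 * j.choose 2 + j := by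
    have := two_mul_choose_two j
    zify
    rw [sq_abs]
    linarith
  rw [e, mul_pow, neg_pow s, pow_add, pow_mul]
  have : (-1 : ℤ⟦X⟧) ^ j * (-1) ^ j = 1 := by rw [← mul_pow]; simp
  linear_combination (-s ^ j * (X ^ 2) ^ j.choose 2 * X ^ j * qFactInv (X ^ 2) j) * this

/-- The numerator $(-q;q^2)_a$ comes from $S_1(a)$, and the denominator with $q^{(a+1)^2}$ from
$S_{-1}(-a-1)$. -/
theorem vTerm_mul (a : ℕ) :
    sqSum (-1) 0 * sqSum 1 0 * vTerm a = sqSum (-1) (-((a : ℤ) + 1)) * sqSum 1 a := by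
  have h1 := sqSum_neg_natCast (-1) (a + 1)
  have h2 := sqSum_natCast (s := 1) (by ring) a
  have h3 := qPoch_mul_invOfUnit (a + 1)
  rw [neg_neg, one_mul] at h1
  rw [one_pow, one_mul, neg_mul, one_mul] at h2
  push_cast at h1
  rw [vTerm, h2]
  calc _ = (X ^ ((a + 1) ^ 2) * sqSum (-1) 0) * sqSum 1 0 * qPoch (-X) (X ^ 2) a *
        invOfUnit (qPoch X (X ^ 2) (a + 1)) 1 := by ring
    _ = sqSum (-1) (-((a : ℤ) + 1)) * (qPoch (-X) (X ^ 2) a * sqSum 1 0) *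
      (qPoch X (X ^ 2) (a + 1) * invOfUnit (qPoch X (X ^ 2) (a + 1)) 1) := by rw [← h1]; ring
    _ = _ := by rw [h3]; ring

theorem evalNegHom_qPoch_X (a : ℕ) :
    evalNegHom (qPoch (X : ℤ⟦X⟧) (X ^ 2) a) = qPoch (-X) (X ^ 2) a := by
  simp [qPoch, map_prod, evalNegHom_X]

theorem evalNegHom_qPoch_neg_X (a : ℕ) :
    evalNegHom (qPoch (-X : ℤ⟦X⟧) (X ^ 2) a) = qPoch X (X ^ 2) a := by
  simp [qPoch, map_prod, evalNegHom_X, sub_eq_add_neg]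

theorem evalNegHom_vTerm_mul (a : ℕ) :
    sqSum (-1) 0 * sqSum 1 0 * evalNegHom (vTerm a) =
      -(sqSum (-1) a * sqSum 1 (-((a : ℤ) + 1))) := by
  have h1 := sqSum_neg_natCast 1 (a + 1)
  have h2 := sqSum_natCast (s := -1) (by ring) a
  have h3 := congrArg evalNegHom (qPoch_mul_invOfUnit (a + 1))
  rw [map_mul, map_one, evalNegHom_qPoch_X] at h3
  rw [neg_neg, one_mul] at h2
  rw [neg_mul, one_mul] at h1
  push_cast at h1
  have h4 : (-X : ℤ⟦X⟧) ^ ((a + 1) ^ 2) = -((-1) ^ a * X ^ ((a + 1) ^ 2)) := by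
    rw [neg_pow, show (a + 1) ^ 2 = a * (a + 1) + (a + 1) by ring, pow_add (-1 : ℤ⟦X⟧),
      (Nat.even_mul_succ_self a).neg_one_pow, pow_succ (-1 : ℤ⟦X⟧)]
    ring
  rw [vTerm, h2, map_mul, map_mul, map_pow, evalNegHom_X, evalNegHom_qPoch_neg_X, h4]
  set I := evalNegHom (invOfUnit (qPoch (X : ℤ⟦X⟧) (X ^ 2) (a + 1)) 1)
  calc _ = -((-1) ^ a * sqSum (-1) 0 * qPoch X (X ^ 2) a * I *
        (X ^ ((a + 1) ^ 2) * sqSum 1 0)) := by ring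
    _ = -((-1) ^ a * sqSum (-1) 0 * qPoch X (X ^ 2) a * sqSum 1 (-((a : ℤ) + 1)) *
      (qPoch (-X) (X ^ 2) (a + 1) * I)) := by rw [← h1]; ring
    _ = _ := by rw [h3]; ring

theorem continuous_of_coeff {φ : ℤ⟦X⟧ → ℤ⟦X⟧}
    (h : ∀ n, ∃ m, ∃ g : ℤ → ℤ, ∀ f, coeff n (φ f) = g (coeff m f)) : Continuous φ := by
  rw [continuous_iff_continuousAt]
  intro f
  rw [ContinuousAt, WithPiTopology.tendsto_iff_coeff_tendsto]
  intro n
  obtain ⟨m, g, hg⟩ := h n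
  simp only [hg]
  exact (continuous_of_discreteTopology.comp (WithPiTopology.continuous_coeff ℤ m)).tendsto f

theorem continuous_evalNegHom : Continuous (evalNegHom : ℤ⟦X⟧ → ℤ⟦X⟧) :=
  continuous_of_coeff fun n => ⟨n, fun x => (-1) ^ n * x, fun f => by
    rw [evalNegHom, coeff_rescale]⟩

theorem hasSum_evalNegHom_vTerm : HasSum (fun a => evalNegHom (vTerm a)) (evalNegHom v) :=
  summable_vTerm.hasSum.map (evalNegHom : ℤ⟦X⟧ →+* ℤ⟦X⟧) continuous_evalNegHom

/-- The indices $n\ge 0$ give $v(q)$ and the indices $n=-a-1$ give $-v(-q)$. -/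
theorem hasSum_sqSum_mul_sqSum : HasSum (fun n : ℤ => sqSum (-1) (-(n + 1)) * sqSum 1 n)
    (sqSum (-1) 0 * sqSum 1 0 * (v - evalNegHom v)) := by
  have h1 := (summable_vTerm.hasSum.mul_left (sqSum (-1) 0 * sqSum 1 0))
  have h2 := (hasSum_evalNegHom_vTerm.mul_left (sqSum (-1) 0 * sqSum 1 0)).neg
  simp only [vTerm_mul] at h1
  simp only [evalNegHom_vTerm_mul, neg_neg] at h2
  have h3 := HasSum.of_nat_of_neg_add_one (f := fun n : ℤ => sqSum (-1) (-(n + 1)) * sqSum 1 n)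
    h1 (h2.congr_fun fun a => ?_)
  · convert h3 using 1
    rw [v]; ring
  · simp

/-! ### Regrouping the bilateral sum into a product -/

/-- Index shear `(n, (j, k)) ↦ ((j, k), n + j)`. -/
def shearEquiv : ℤ × (ℕ × ℕ) ≃ (ℕ × ℕ) × ℤ where
  toFun p := (p.2, p.1 + p.2.1)
  invFun p := (p.2 - p.1.1, p.1)
  left_inv p := by simp
  right_inv p := by simp

/-- The summand after regrouping. -/
def regroupedTerm (p : (ℕ × ℕ) × ℤ) : ℤ⟦X⟧ :=
  (-1) ^ p.1.1 * qFactInv (X ^ 2) p.1.1 * qFactInv (X ^ 2) p.1.2 *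
    X ^ ((p.2 + 1).natAbs ^ 2 + ((p.1.1 + p.1.2 : ℕ) - p.2).natAbs ^ 2)

theorem summable_regroupedTerm : Summable regroupedTerm := by
  refine summable_of_X_pow_dvd _ (fun p => Dvd.intro_left _ rfl) fun n => ?_
  refine (((Set.finite_Iic (2 * n)).prod (Set.finite_Iic (2 * n))).prod
    (Set.finite_Icc (-(n : ℤ) - 1) n)).subset fun p hp => ?_
  simp only [Set.mem_ofPred_eq] at hp
  have h1 : (p.2 + 1).natAbs ≤ n := (Nat.le_self_pow two_ne_zero _).trans (by omega)
  have h2 : ((p.1.1 + p.1.2 : ℕ) - p.2).natAbs ≤ n :=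
    (Nat.le_self_pow two_ne_zero _).trans (by omega)
  simp only [Set.mem_prod, Set.mem_Iic, Set.mem_Icc]
  omega

theorem regroupedTerm_shearEquiv (n : ℤ) (p : ℕ × ℕ) : regroupedTerm (shearEquiv (n, p)) =
    ((-1) ^ p.1 * X ^ (((p.1 : ℤ) - -(n + 1)).natAbs ^ 2) * qFactInv (X ^ 2) p.1) *
      (1 ^ p.2 * X ^ (((p.2 : ℤ) - n).natAbs ^ 2) * qFactInv (X ^ 2) p.2) := by
  simp only [regroupedTerm, shearEquiv, Equiv.coe_fn_mk]
  rw [show n + (p.1 : ℤ) + 1 = p.1 - -(n + 1) by ring,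
    show ((p.1 + p.2 : ℕ) : ℤ) - (n + p.1) = p.2 - n by push_cast; ring, pow_add]
  ring

theorem sqSum_mul_sqSum (n : ℤ) :
    HasSum (fun p : ℕ × ℕ => regroupedTerm (shearEquiv (n, p)))
      (sqSum (-1) (-(n + 1)) * sqSum 1 n) := by
  have hs : Summable fun p : ℕ × ℕ => regroupedTerm (shearEquiv (n, p)) :=
    Summable.comp_injective (f := regroupedTerm) (i := fun p => shearEquiv (n, p))
      summable_regroupedTerm fun p p' h => (Prod.ext_iff.mp (shearEquiv.injective h)).2
  have h1 := (summable_sqSum (-(n + 1)) fun j => (-1) ^ j).hasSum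
  have h2 := (summable_sqSum n fun j => 1 ^ j).hasSum
  have h3 := h1.mul h2 (hs.congr (regroupedTerm_shearEquiv n))
  exact h3.congr_fun (regroupedTerm_shearEquiv n)

theorem summable_X_pow_two_mul_mul_succ :
    Summable fun s : ℤ => (X : ℤ⟦X⟧) ^ (2 * s * (s + 1)).toNat := by
  refine summable_of_X_pow_dvd _ (fun _ => dvd_rfl) fun n => ?_
  refine (Set.finite_Icc (-(n : ℤ) - 1) n).subset fun s hs => ?_
  simp only [Set.mem_ofPred_eq] at hs
  have : 2 * s * (s + 1) ≤ n := by omega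
  simp only [Set.mem_Icc]
  constructor <;> nlinarith

/-- Centre at $m=M+s$: $(M+s+1)^2+(M-s)^2=2M^2+2M+1+2s(s+1)$. -/
theorem tsum_X_pow_even (M : ℕ) :
    ∑' m : ℤ, (X : ℤ⟦X⟧) ^ ((m + 1).natAbs ^ 2 + ((2 * M : ℕ) - m).natAbs ^ 2) =
      X ^ (2 * M ^ 2 + 2 * M + 1) * ∑' s : ℤ, X ^ (2 * s * (s + 1)).toNat := by
  rw [← (Equiv.addLeft (M : ℤ)).tsum_eq, ← summable_X_pow_two_mul_mul_succ.tsum_mul_left]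
  refine tsum_congr fun s => ?_
  rw [← pow_add]
  congr 1
  have h0 : 0 ≤ 2 * s * (s + 1) := by
    rcases le_or_gt 0 s with h | h <;> nlinarith
  zify
  rw [Int.toNat_of_nonneg h0, sq_abs, sq_abs]
  simp only [Equiv.coe_addLeft]
  ring

/-- Odd $s=2m-1$ and even $s=-2m$ both give the exponent $8m^2-4m$, hence one copy of $\psi(q^4)$
each. -/
theorem tsum_eq_two_mul_psi :
    ∑' s : ℤ, (X : ℤ⟦X⟧) ^ (2 * s * (s + 1)).toNat = 2 * psi (X ^ 4) := by
  have hs : Summable fun m : ℤ => thetaTerm (X ^ 4) ((X ^ 4) ^ 3) m :=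
    summable_thetaTerm (dvd_pow_self X four_ne_zero)
      ((dvd_pow_self X four_ne_zero).trans (dvd_pow_self _ three_ne_zero))
  have hpsi : HasSum (fun m : ℤ => thetaTerm (X ^ 4) ((X ^ 4) ^ 3) m) (psi (X ^ 4)) := hs.hasSum
  have hexp : ∀ m : ℤ, thetaTerm (X ^ 4) ((X ^ 4) ^ 3) m = X ^ (8 * m ^ 2 - 4 * m).toNat := by
    intro m
    rw [thetaTerm, ← pow_mul, ← pow_mul, ← pow_mul, ← pow_add]
    congr 1
    have h1 := two_mul_toNat_triangular m
    have h2 := two_mul_toNat_triangular' m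
    have : ((8 * m ^ 2 - 4 * m).toNat : ℤ) = 8 * m ^ 2 - 4 * m :=
      Int.toNat_of_nonneg (by rcases le_or_gt 1 m with h | h <;> nlinarith)
    zify
    rw [this]
    linarith
  simp only [hexp] at hpsi
  rw [two_mul]
  refine HasSum.tsum_eq ?_
  refine HasSum.add_isCompl (s := Set.range fun m : ℤ => 2 * m - 1)
    (t := Set.range fun m : ℤ => -(2 * m)) ?_ ?_ ?_
  · rw [isCompl_iff, Set.disjoint_iff_forall_ne, codisjoint_iff]
    refine ⟨?_, ?_⟩
    · rintro _ ⟨a, rfl⟩ _ ⟨b, rfl⟩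
      dsimp only
      omega
    · ext s
      simp only [Set.sup_eq_union, Set.mem_union, Set.mem_range, Set.top_eq_univ, Set.mem_univ,
        iff_true]
      rcases Int.even_or_odd' s with ⟨k, rfl | rfl⟩
      · exact Or.inr ⟨-k, by ring⟩
      · exact Or.inl ⟨k + 1, by ring⟩
  · refine (Function.Injective.hasSum_range_iff
      (f := fun s : ℤ => (X : ℤ⟦X⟧) ^ (2 * s * (s + 1)).toNat)
      (g := fun m : ℤ => 2 * m - 1) (fun a b h => by simpa using h)).mpr ?_
    refine hpsi.congr_fun fun m => ?_
    simp only [Function.comp_apply]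
    ring_nf
  · refine (Function.Injective.hasSum_range_iff
      (f := fun s : ℤ => (X : ℤ⟦X⟧) ^ (2 * s * (s + 1)).toNat)
      (g := fun m : ℤ => -(2 * m)) (fun a b h => by simpa using h)).mpr ?_
    refine hpsi.congr_fun fun m => ?_
    simp only [Function.comp_apply]
    ring_nf

theorem hasSum_altConv : HasSum (fun N : ℕ => altConv (X ^ 2) N *
      ∑' m : ℤ, (X : ℤ⟦X⟧) ^ ((m + 1).natAbs ^ 2 + ((N : ℤ) - m).natAbs ^ 2))
    (∑' p, regroupedTerm p) := by
  have h1 := summable_regroupedTerm.hasSum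
  have h2 := h1.prod_fiberwise fun p => (summable_regroupedTerm.prod_factor p).hasSum
  have h3 := (Finset.HasAntidiagonal.sigmaAntidiagonalEquivProd (A := ℕ)).hasSum_iff.mpr h2
  have h4 := h3.sigma fun N => hasSum_fintype _
  convert h4 using 1
  funext N
  rw [altConv, Finset.sum_mul]
  rw [← Finset.sum_coe_sort]
  refine Finset.sum_congr rfl fun p _ => ?_
  have hp := Finset.HasAntidiagonal.mem_antidiagonal.mp p.2
  simp only [Function.comp_apply, Finset.HasAntidiagonal.sigmaAntidiagonalEquivProd_apply, regroupedTerm]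
  rw [hp]
  refine (Summable.tsum_mul_left _ ?_).symm
  refine summable_of_X_pow_dvd _ (fun _ => dvd_rfl) fun n => ?_
  refine (finite_natAbs_sq_le n).preimage (f := fun m : ℤ => m + 1) (fun a _ b _ h => by simpa using h)
    |>.subset fun m hm => ?_
  simp only [Set.mem_ofPred_eq, Set.mem_preimage] at hm ⊢
  omega

/-- The product formula for `v(q) - v(-q)`, twice the odd part of `v`. -/
theorem qPochInf_mul_v_sub :
    qPochInf (X ^ 2) ((X ^ 2) ^ 2) * (v - evalNegHom v) =
      2 * X * (psi ((X ^ 2) ^ 2) * qPochInf (-(X ^ 2) ^ 2) ((X ^ 2) ^ 2)) := by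
  have h0 : sqSum (-1) 0 * sqSum 1 0 = qPochInf (X ^ 2) ((X ^ 2) ^ 2) := by
    rw [sqSum_zero, sqSum_zero, neg_neg, one_mul, neg_mul, one_mul, qPochInf_mul_neg _ X_dvd_X_sq]
  have h1 : ∑' p, regroupedTerm p = sqSum (-1) 0 * sqSum 1 0 * (v - evalNegHom v) := by
    have h := (shearEquiv.hasSum_iff.mpr summable_regroupedTerm.hasSum).prod_fiberwise sqSum_mul_sqSum
    exact h.unique hasSum_sqSum_mul_sqSum
  have h4 : (X : ℤ⟦X⟧) ∣ X ^ 4 := dvd_pow_self X four_ne_zero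
  have h2 : HasSum (fun M : ℕ => X * (2 * psi (X ^ 4)) *
      (((-1) ^ M * (X ^ 4) ^ M.choose 2 * qFactInv (X ^ 4) M) * (-X ^ 4) ^ M))
      (∑' p, regroupedTerm p) := by
    have h := hasSum_altConv
    have hinj : Function.Injective fun M : ℕ => 2 * M := fun a b h => by simpa using h
    rw [← hinj.hasSum_iff] at h
    · convert h using 1
      funext M
      simp only [Function.comp_apply]
      rw [altConv_even X_dvd_X_sq, tsum_X_pow_even, tsum_eq_two_mul_psi,
        show ((X : ℤ⟦X⟧) ^ 2) ^ 2 = X ^ 4 from (pow_mul X 2 2).symm]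
      -- With this exponent the sum over $M$ is Euler's series in base $q^4$ at $z=-q^4$.
      have e : 2 * M ^ 2 + 2 * M + 1 = 4 * M.choose 2 + 4 * M + 1 := by
        have := two_mul_choose_two M
        zify
        linarith
      have e2 : (-1 : ℤ⟦X⟧) ^ M * (-1) ^ M = 1 := by rw [← mul_pow]; simp
      rw [e, neg_pow (X ^ 4) M, show (X : ℤ⟦X⟧) ^ (4 * M.choose 2 + 4 * M + 1) =
        (X ^ 4) ^ M.choose 2 * (X ^ 4) ^ M * X by rw [pow_succ, pow_add, pow_mul, pow_mul]]
      linear_combination (X * (2 * psi (X ^ 4)) * (X ^ 4) ^ M.choose 2 * qFactInv (X ^ 4) M *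
        (X ^ 4) ^ M) * e2
    · intro N hN
      obtain ⟨k, rfl | rfl⟩ := Nat.even_or_odd' N
      · exact absurd ⟨k, rfl⟩ hN
      · rw [altConv_odd X_dvd_X_sq, zero_mul]
  have h3 := h2.tsum_eq
  rw [(summable_euler h4.neg_right _).tsum_mul_left, tsum_euler h4 h4.neg_right] at h3
  rw [← h0, ← h1, ← h3, show ((X : ℤ⟦X⟧) ^ 2) ^ 2 = X ^ 4 from (pow_mul X 2 2).symm]
  ring

/-! ### The generating function of the odd-indexed coefficients -/

theorem continuous_expand {k : ℕ} (hk : k ≠ 0) : Continuous (expand k hk : ℤ⟦X⟧ → ℤ⟦X⟧) :=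
  continuous_of_coeff fun n => ⟨n / k, fun x => if k ∣ n then x else 0, fun f => by
    rw [coeff_expand]⟩

theorem expand_qPochInf {k : ℕ} (hk : k ≠ 0) (b : ℤ⟦X⟧) {q : ℤ⟦X⟧} (hq : X ∣ q) :
    expand k hk (qPochInf b q) = qPochInf (expand k hk b) (expand k hk q) := by
  have h := (multipliable_qPochInf b hq).hasProd.map (expand k hk : ℤ⟦X⟧ →ₐ[ℤ] ℤ⟦X⟧)
    (continuous_expand hk)
  rw [qPochInf, ← h.tprod_eq]
  exact tprod_congr fun i => by simp

theorem expand_psi {k : ℕ} (hk : k ≠ 0) {q : ℤ⟦X⟧} (hq : X ∣ q) :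
    expand k hk (psi q) = psi (expand k hk q) := by
  have hs : Summable (thetaTerm q (q ^ 3)) :=
    summable_thetaTerm hq (hq.trans (dvd_pow_self _ three_ne_zero))
  have h := hs.hasSum.map (expand k hk : ℤ⟦X⟧ →ₐ[ℤ] ℤ⟦X⟧) (continuous_expand hk)
  have h0 : psi q = ∑' m, thetaTerm q (q ^ 3) m := rfl
  rw [h0, ← h.tsum_eq]
  exact tsum_congr fun i => by simp [thetaTerm]

/-- The generating function `∑ P_v(2n+1) q^n`. -/
def oddPart : ℤ⟦X⟧ := PowerSeries.mk fun n => Pv (2 * n + 1)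

theorem v_sub_evalNegHom : v - evalNegHom v = 2 * X * expand 2 two_ne_zero oddPart := by
  ext n
  rw [map_sub, evalNegHom, coeff_rescale, mul_assoc, two_mul, map_add]
  rcases n with _ | n
  · simp
  · rw [coeff_succ_X_mul, coeff_expand]
    split_ifs with h
    · obtain ⟨m, rfl⟩ := h
      rw [Nat.mul_div_cancel_left _ two_pos, oddPart, coeff_mk, Pv, pow_succ, pow_mul]
      simp
    · have : Even (n + 1) := by
        rw [Nat.even_add_one, even_iff_two_dvd]; exact h
      simp [this.neg_one_pow]

theorem oddPart_mul_qPochInf :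
    oddPart * qPochInf X (X ^ 2) = psi (X ^ 2) * qPochInf (-X ^ 2) (X ^ 2) := by
  have hinj : Function.Injective (expand 2 two_ne_zero : ℤ⟦X⟧ → ℤ⟦X⟧) := fun f g h => by
    ext n
    rw [← coeff_expand_mul 2 two_ne_zero f, h, coeff_expand_mul]
  apply hinj
  have h := qPochInf_mul_v_sub
  rw [v_sub_evalNegHom] at h
  rw [map_mul, map_mul, expand_qPochInf _ _ X_dvd_X_sq, expand_qPochInf _ _ X_dvd_X_sq,
    expand_psi _ X_dvd_X_sq, map_neg, map_pow, expand_X]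
  have h2 : (2 * X : ℤ⟦X⟧) ≠ 0 := fun h => by
    have := congrArg (coeff 1) h
    rw [coeff_succ_mul_X, coeff_zero_eq_constantCoeff_apply, map_ofNat, map_zero] at this
    exact two_ne_zero this
  apply mul_left_cancel₀ h2
  rw [← h]
  ring

/-- A cube is wanted because modulo 3 it is a series in $q^3$; what remains is the sparse series
$\sum(-1)^mq^{m^2}$. -/
theorem oddPart_mul_pow_three :
    oddPart * (qPochInf X (X ^ 2) * qPochInf (X ^ 2) ((X ^ 2) ^ 2)) ^ 3 = theta (-X) (-X) := by
  have h4 : (X : ℤ⟦X⟧) ∣ (X ^ 2) ^ 2 := X_dvd_X_sq.trans (dvd_pow_self _ two_ne_zero)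
  have h1 := oddPart_mul_qPochInf
  have h2 := psi_mul_qPochInf X_dvd_X_sq
  have h3 := qPochInf_neg_mul_odd X_dvd_X_sq
  have h5 := qPochInf_even_mul_odd (X ^ 2) X_dvd_X_sq
  rw [← sq] at h5
  rw [theta_neg_neg dvd_rfl]
  set A := qPochInf (X : ℤ⟦X⟧) (X ^ 2)
  set B := qPochInf (X ^ 2 : ℤ⟦X⟧) ((X ^ 2) ^ 2)
  linear_combination A ^ 2 * B ^ 3 * h1 + A ^ 2 * B ^ 2 * qPochInf (-X ^ 2) (X ^ 2) * h2 +
    A ^ 2 * B * qPochInf ((X ^ 2) ^ 2) ((X ^ 2) ^ 2) * h3 + A ^ 2 * h5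

/-! ### Frobenius modulo $p$ and the congruence modulo 3 -/

section Reduction

variable (p : ℕ)

/-- Reduction of the coefficients modulo `p`. -/
abbrev red : ℤ⟦X⟧ →+* (ZMod p)⟦X⟧ := PowerSeries.map (Int.castRingHom (ZMod p))

theorem red_eq_iff {f g : ℤ⟦X⟧} : red p f = red p g ↔ SeriesModEq p f g := by
  simp only [PowerSeries.ext_iff, coeff_map, eq_intCast, SeriesModEq, ZMod.intCast_eq_intCast_iff]

/-- The polynomial case applies to a truncation of $f$. The discarded tail $X^{n+1}g$ stays
divisible by $X^{n+1}$ under both operations, so the $n$-th coefficients agree. -/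
theorem expand_eq_pow [Fact p.Prime] (f : (ZMod p)⟦X⟧) :
    expand p (NeZero.ne p) f = f ^ p := by
  have : CharP (ZMod p)⟦X⟧ p := charP_of_injective_ringHom (C_injective (R := ZMod p)) p
  have hp : p ≠ 0 := NeZero.ne p
  ext n
  have h1 : (X : (ZMod p)⟦X⟧) ^ (n + 1) ∣ f - (trunc (n + 1) f : (ZMod p)⟦X⟧) := by
    rw [X_pow_dvd_iff]
    intro m hm
    simp [coeff_trunc, hm]
  obtain ⟨g, hg⟩ := h1
  rw [sub_eq_iff_eq_add] at hg
  have h2 : expand p hp (trunc (n + 1) f : (ZMod p)⟦X⟧) =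
      (trunc (n + 1) f : (ZMod p)⟦X⟧) ^ p := by
    rw [← Polynomial.coe_pow, ← ZMod.expand_card]
    ext m
    rw [coeff_expand, Polynomial.coeff_coe, Polynomial.coeff_coe,
      Polynomial.coeff_expand (Nat.pos_of_ne_zero hp)]
  have h3 : (X : (ZMod p)⟦X⟧) ^ (n + 1) ∣ expand p hp f - f ^ p := by
    rw [hg, map_add, h2, add_pow_char, map_mul, map_pow, expand_X, mul_pow]
    rw [add_sub_add_right_eq_sub]
    apply dvd_sub
    · exact (pow_dvd_pow_of_dvd (dvd_pow_self X hp) _).mul_right _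
    · exact (dvd_pow_self _ hp).mul_right _
  have := X_pow_dvd_iff.mp h3 n (Nat.lt_succ_self n)
  rwa [map_sub, sub_eq_zero] at this

theorem red_expand [Fact p.Prime] (f : ℤ⟦X⟧) :
    red p (expand p (NeZero.ne p) f) = red p f ^ p := by
  rw [← expand_eq_pow, map_expand]

end Reduction

theorem coeff_theta_neg_X {n : ℕ} (hn : ∀ m : ℕ, m ^ 2 ≠ n) :
    coeff n (theta (-X : ℤ⟦X⟧) (-X)) = 0 := by
  have hX : (X : ℤ⟦X⟧) ∣ -X := (dvd_refl X).neg_right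
  have h := (WithPiTopology.hasSum_iff_hasSum_coeff ℤ).mp (summable_thetaTerm hX hX).hasSum n
  rw [show theta (-X : ℤ⟦X⟧) (-X) = ∑' m, thetaTerm (-X) (-X) m from rfl, ← h.tsum_eq]
  refine (tsum_congr fun m => ?_).trans tsum_zero
  have e : (m * (m + 1) / 2).toNat + (m * (m - 1) / 2).toNat = m.natAbs ^ 2 := by
    zify
    rw [sq_abs]
    linarith [two_mul_toNat_triangular m, two_mul_toNat_triangular' m]
  rw [thetaTerm, ← pow_add, e, neg_pow, ← map_one (C (R := ℤ)), ← map_neg, ← map_pow, coeff_C_mul,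
    coeff_X_pow, if_neg (hn _).symm, mul_zero]

theorem Pv_six_mul_add_five (n : ℕ) : Pv (6 * n + 5) ≡ 0 [ZMOD 3] := by
  have : Fact (Nat.Prime 3) := ⟨Nat.prime_three⟩
  set W : ℤ⟦X⟧ := qPochInf X (X ^ 2) * qPochInf (X ^ 2) ((X ^ 2) ^ 2)
  have h4 : (X : ℤ⟦X⟧) ∣ (X ^ 2) ^ 2 := X_dvd_X_sq.trans (dvd_pow_self _ two_ne_zero)
  obtain ⟨U, hU⟩ : ∃ U, W * U = 1 := by
    have e1 := tsum_euler_inv X_dvd_X_sq (dvd_refl X)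
    have e2 := tsum_euler_inv h4 X_dvd_X_sq
    refine ⟨(∑' j : ℕ, qFactInv (X ^ 2) j * X ^ j) *
      ∑' j : ℕ, qFactInv ((X ^ 2) ^ 2) j * (X ^ 2) ^ j, ?_⟩
    rw [mul_mul_mul_comm, mul_comm (qPochInf X _), e1, mul_comm (qPochInf _ _), e2, one_mul]
  have h1 : red 3 oddPart = red 3 (theta (-X) (-X) * expand 3 three_ne_zero U) := by
    rw [← oddPart_mul_pow_three, map_mul, map_mul, map_pow]
    have h := red_expand 3 U
    rw [h, mul_assoc, ← mul_pow, ← map_mul, hU, map_one, one_pow, mul_one]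
  have h2 := (red_eq_iff 3).mp h1 (3 * n + 2)
  rw [oddPart, coeff_mk, show 2 * (3 * n + 2) + 1 = 6 * n + 5 by ring] at h2
  refine h2.trans ?_
  rw [coeff_mul, Finset.sum_eq_zero]
  intro p hp
  have hp' := Finset.HasAntidiagonal.mem_antidiagonal.mp hp
  by_cases h3 : 3 ∣ p.2
  · rw [coeff_theta_neg_X, zero_mul]
    intro m hm
    -- The second exponent is a multiple of 3, so the square would have the residue of $3n+2$.
    have h5 : m ^ 2 % 3 = 2 := by omega
    rw [Nat.pow_mod] at h5
    have h6 : m % 3 < 3 := Nat.mod_lt _ (by norm_num)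
    interval_cases m % 3 <;> simp at h5
  · rw [coeff_expand_of_not_dvd _ _ _ h3, mul_zero]

/-! ### Reduction modulo 2 -/

theorem psi_mul_qPochInf_self {q : ℤ⟦X⟧} (hq : X ∣ q) :
    psi q * qPochInf q q = qPochInf (q ^ 2) (q ^ 2) ^ 2 := by
  have h1 := psi_mul_qPochInf hq
  have h2 := qPochInf_even_mul_odd q hq
  rw [← sq] at h2
  rw [← h2, ← mul_assoc, h1, sq (qPochInf _ _)]

theorem red_ne_zero {p : ℕ} [Fact p.Prime] {b q : ℤ⟦X⟧} (hb : X ∣ b) (hq : X ∣ q) :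
    red p (qPochInf b q) ≠ 0 := fun h => by
  have := congrArg (red p) (tsum_euler_inv hq hb)
  rw [map_mul, h, mul_zero, map_one] at this
  exact zero_ne_one this

theorem red_two_ell {k : ℕ} (hk : k ≠ 0) :
    red 2 (qPochInf ((X ^ k) ^ 2) ((X ^ k) ^ 2)) = red 2 (ell k) ^ 2 := by
  have hX : (X : ℤ⟦X⟧) ∣ X ^ k := dvd_pow_self X hk
  have h := red_expand 2 (ell k)
  rw [← h, ell, expand_qPochInf _ _ hX, map_pow, expand_X, ← pow_mul, ← pow_mul, mul_comm]

/-- $\psi(q)(q;q)_\infty=(q^2;q^2)_\infty^2\equiv(q;q)_\infty^4$, and one factor cancels. -/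
theorem red_two_psi {k : ℕ} (hk : k ≠ 0) : red 2 (psi (X ^ k)) = red 2 (ell k) ^ 3 := by
  have hX : (X : ℤ⟦X⟧) ∣ X ^ k := dvd_pow_self X hk
  apply mul_right_cancel₀ (red_ne_zero (p := 2) hX hX)
  rw [← map_mul, psi_mul_qPochInf_self hX, map_pow, red_two_ell hk, ell]
  ring

theorem red_two_oddPart : red 2 oddPart = red 2 (psi X * psi (X ^ 2)) := by
  have hX : (X : ℤ⟦X⟧) ∣ X := dvd_rfl
  have h1 := congrArg (red 2) oddPart_mul_qPochInf
  have h2 := congrArg (red 2) (psi_mul_qPochInf hX)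
  have h3 := congrArg (red 2) (qPochInf_mul_neg (X ^ 2) X_dvd_X_sq)
  have h4 := red_two_ell two_ne_zero
  rw [ell] at h4
  rw [h4] at h3
  simp only [map_mul] at h1 h2 h3
  rw [show -(X : ℤ⟦X⟧) ^ 2 = -(X ^ 2) from rfl] at h1
  have h5 : red 2 (qPochInf (-(X ^ 2)) (X ^ 2)) = red 2 (qPochInf (X ^ 2) (X ^ 2)) := by
    apply mul_left_cancel₀ (red_ne_zero (p := 2) X_dvd_X_sq X_dvd_X_sq)
    rw [h3, sq]
  apply mul_right_cancel₀ (red_ne_zero (p := 2) hX X_dvd_X_sq)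
  rw [h1, h5, map_mul, ← h2]
  ring

/-! ### Coefficients as counts of representations by $x^2+2y^2$ -/

/-- The number of representations of `N` as `x² + 2y²` with `x, y ≥ 0`. -/
def repCount (N : ℕ) : ℕ := Nat.card {p : ℕ × ℕ // p.1 ^ 2 + 2 * p.2 ^ 2 = N}

theorem coeff_of_hasSum_X_pow {ι : Type*} {g : ι → ℕ} (hg : ∀ n, {i | g i ≤ n}.Finite)
    {F : ℤ⟦X⟧} (hF : HasSum (fun i => X ^ g i) F) (n : ℕ) :
    coeff n F = Nat.card {i // g i = n} := by
  have h := (WithPiTopology.hasSum_iff_hasSum_coeff ℤ).mp hF n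
  have hfin : {i | g i = n}.Finite := (hg n).subset fun i hi => le_of_eq hi
  rw [← h.tsum_eq, tsum_eq_sum (s := hfin.toFinset)]
  · rw [Finset.sum_congr rfl (g := fun _ => (1 : ℤ))]
    · rw [Finset.sum_const, nsmul_one]
      congr 1
      exact (Nat.card_eq_card_finite_toFinset hfin).symm
    · intro i hi
      rw [coeff_X_pow, if_pos]
      exact ((Set.Finite.mem_toFinset _).mp hi).symm
  · intro i hi
    rw [coeff_X_pow, if_neg]
    exact fun h => hi ((Set.Finite.mem_toFinset _).mpr h.symm)

theorem hasSum_X_pow_mul {ι κ : Type*} {g : ι → ℕ} {h : κ → ℕ} (hg : ∀ n, {i | g i ≤ n}.Finite)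
    (hh : ∀ n, {i | h i ≤ n}.Finite) {F G : ℤ⟦X⟧} (hF : HasSum (fun i => X ^ g i) F)
    (hG : HasSum (fun i => X ^ h i) G) :
    (∀ n, {p : ι × κ | g p.1 + h p.2 ≤ n}.Finite) ∧
      HasSum (fun p : ι × κ => X ^ (g p.1 + h p.2)) (F * G) := by
  have hfin : ∀ n, {p : ι × κ | g p.1 + h p.2 ≤ n}.Finite := fun n =>
    ((hg n).prod (hh n)).subset fun p hp => by
      simp only [Set.mem_ofPred_eq] at hp
      exact ⟨(Nat.le_add_right _ _).trans hp, (Nat.le_add_left _ _).trans hp⟩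
  refine ⟨hfin, ?_⟩
  have hs : Summable fun p : ι × κ => (X : ℤ⟦X⟧) ^ g p.1 * X ^ h p.2 :=
    summable_of_X_pow_dvd _ (fun p => (pow_add X (g p.1) (h p.2)).dvd) hfin
  exact (hF.mul hG hs).congr_fun fun p => pow_add _ _ _

theorem natCast_two_mul_sq_sub (m : ℤ) : ((2 * m ^ 2 - m).toNat : ℤ) = 2 * m ^ 2 - m :=
  Int.toNat_of_nonneg (by rcases le_or_gt 1 m with h | h <;> nlinarith)

theorem finite_mul_two_mul_sq_sub_le {k : ℕ} (hk : k ≠ 0) (n : ℕ) :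
    {m : ℤ | k * (2 * m ^ 2 - m).toNat ≤ n}.Finite := by
  refine (finite_natAbs_sq_le n).subset fun m hm => ?_
  simp only [Set.mem_ofPred_eq] at hm ⊢
  have h1 : (2 * m ^ 2 - m).toNat ≤ n := (Nat.le_mul_of_pos_left _ (Nat.pos_of_ne_zero hk)).trans hm
  refine le_trans ?_ h1
  zify
  rw [natCast_two_mul_sq_sub, sq_abs]
  rcases le_or_gt 1 m with h | h <;> nlinarith

theorem hasSum_psi {k : ℕ} (hk : k ≠ 0) :
    HasSum (fun m : ℤ => (X : ℤ⟦X⟧) ^ (k * (2 * m ^ 2 - m).toNat)) (psi (X ^ k)) := by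
  have hX : (X : ℤ⟦X⟧) ∣ X ^ k := dvd_pow_self X hk
  have hs : HasSum (thetaTerm (X ^ k) ((X ^ k) ^ 3)) (psi (X ^ k)) :=
    (summable_thetaTerm hX (hX.trans (dvd_pow_self _ three_ne_zero))).hasSum
  refine hs.congr_fun fun m => ?_
  rw [thetaTerm, ← pow_mul, ← pow_mul, ← pow_mul, ← pow_add, ← mul_add]
  congr 2
  have h1 := two_mul_toNat_triangular m
  have h2 := two_mul_toNat_triangular' m
  zify
  rw [natCast_two_mul_sq_sub]
  linarith

theorem odd_of_sq_add_two_mul_sq {x y N : ℕ} (h : x ^ 2 + 2 * y ^ 2 = 8 * N + 3) :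
    x % 2 = 1 ∧ y % 2 = 1 := by
  have key : ∀ a b : ZMod 8, a ^ 2 + 2 * b ^ 2 = 3 → a.val % 2 = 1 ∧ b.val % 2 = 1 := by decide
  have h8 : (8 : ZMod 8) = 0 := rfl
  have := key x y (by
    have := congrArg (Nat.cast : ℕ → ZMod 8) h
    push_cast at this
    rw [this, h8, zero_mul, zero_add])
  rw [ZMod.val_natCast, ZMod.val_natCast] at this
  omega

theorem coeff_psi_mul_psi (n : ℕ) :
    coeff n (psi X * psi (X ^ 2)) = repCount (8 * n + 3) := by
  have h1 := hasSum_psi one_ne_zero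
  have h2 := hasSum_psi two_ne_zero
  obtain ⟨hfin, hs⟩ := hasSum_X_pow_mul (finite_mul_two_mul_sq_sub_le one_ne_zero)
    (finite_mul_two_mul_sq_sub_le two_ne_zero) h1 h2
  rw [pow_one] at hs
  rw [coeff_of_hasSum_X_pow hfin hs, repCount]
  congr 1
  -- $(4a-1)^2=8(2a^2-a)+1$, and $|4a-1|$ takes each odd positive value exactly once.
  have hN : ∀ a b : ℤ, (4 * a - 1).natAbs ^ 2 + 2 * (4 * b - 1).natAbs ^ 2 = 8 * n + 3 ↔
      1 * (2 * a ^ 2 - a).toNat + 2 * (2 * b ^ 2 - b).toNat = n := by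
    intro a b
    zify
    rw [natCast_two_mul_sq_sub, natCast_two_mul_sq_sub, sq_abs, sq_abs]
    constructor <;> intro h <;> linarith
  refine Nat.card_eq_of_bijective
    (fun p => ⟨((4 * p.1.1 - 1).natAbs, (4 * p.1.2 - 1).natAbs), (hN _ _).mpr p.2⟩) ⟨?_, ?_⟩
  · rintro ⟨⟨a, b⟩, h⟩ ⟨⟨a', b'⟩, h'⟩ heq
    simp only [Subtype.mk.injEq, Prod.mk.injEq] at heq ⊢
    omega
  · rintro ⟨⟨x, y⟩, h⟩
    have ho := odd_of_sq_add_two_mul_sq h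
    have hex : ∀ x : ℕ, x % 2 = 1 → ∃ a : ℤ, (4 * a - 1).natAbs = x := by
      intro x hx
      rcases (by omega : x % 4 = 1 ∨ x % 4 = 3) with h | h
      · exact ⟨-((x : ℤ) / 4), by omega⟩
      · exact ⟨(x + 1 : ℤ) / 4, by omega⟩
    obtain ⟨a, rfl⟩ := hex x ho.1
    obtain ⟨b, rfl⟩ := hex y ho.2
    exact ⟨⟨(a, b), (hN a b).mp h⟩, rfl⟩

theorem finite_pentagonal_le (n : ℕ) : {k : ℤ | pentagonal k ≤ n}.Finite := by
  refine (finite_natAbs_sq_le n).subset fun m hm => ?_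
  simp only [Set.mem_ofPred_eq] at hm ⊢
  refine le_trans ?_ hm
  zify
  have := two_mul_natCast_pentagonal m
  rw [sq_abs]
  rcases le_or_gt 1 m with h | h <;> nlinarith

theorem ell_one : ell 1 = pentagonalSeries ℤ := by
  rw [← PowerSeries.WithPiTopology.tprod_one_sub_X_pow, ell, qPochInf]
  exact tprod_congr fun k => by ring

/-- Euler's pentagonal number theorem, whose signs disappear modulo 2. -/
theorem red_two_ell_one :
    red 2 (ell 1) = red 2 (∑' k : ℤ, X ^ pentagonal k) := by
  have hs : Summable fun k : ℤ => (X : ℤ⟦X⟧) ^ pentagonal k :=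
    summable_of_X_pow_dvd _ (fun _ => dvd_rfl) finite_pentagonal_le
  rw [red_eq_iff]
  intro n
  rw [ell_one, coeff_of_hasSum_X_pow finite_pentagonal_le hs.hasSum]
  by_cases hn : n ∈ Set.range pentagonal
  · obtain ⟨k, rfl⟩ := hn
    have : Nat.card {i // pentagonal i = pentagonal k} = 1 := by
      simp [pentagonal_inj]
    rw [coeff_pentagonalSeries_pentagonal, this]
    rcases Int.even_or_odd k with h | h
    · simp [Int.negOnePow_even k h]
    · simp [Int.negOnePow_odd k h, Int.ModEq]
  · have : Nat.card {i // pentagonal i = n} = 0 := by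
      have : IsEmpty {i // pentagonal i = n} := ⟨fun i => hn ⟨i.1, i.2⟩⟩
      exact Nat.card_of_isEmpty
    rw [coeff_pentagonalSeries_eq_zero ℤ hn, this]
    rfl

theorem coeff_pentagonal_mul_psi (n : ℕ) :
    coeff n ((∑' k : ℤ, (X : ℤ⟦X⟧) ^ pentagonal k) * psi (X ^ 6)) = repCount (24 * n + 19) := by
  have h1 : Summable fun k : ℤ => (X : ℤ⟦X⟧) ^ pentagonal k :=
    summable_of_X_pow_dvd _ (fun _ => dvd_rfl) finite_pentagonal_le
  have h6 : (6 : ℕ) ≠ 0 := by norm_num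
  obtain ⟨hfin, hs⟩ := hasSum_X_pow_mul finite_pentagonal_le
    (finite_mul_two_mul_sq_sub_le h6) h1.hasSum (hasSum_psi h6)
  rw [coeff_of_hasSum_X_pow hfin hs, repCount]
  congr 1
  -- Uses $(6a-1)^2=24\cdot\frac{a(3a-1)}2+1$ and $18(4b-1)^2=144(2b^2-b)+18$.
  have hN : ∀ a b : ℤ, (6 * a - 1).natAbs ^ 2 + 2 * (3 * (4 * b - 1).natAbs) ^ 2 = 24 * n + 19 ↔
      pentagonal a + 6 * (2 * b ^ 2 - b).toNat = n := by
    intro a b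
    have := two_mul_natCast_pentagonal a
    zify
    rw [natCast_two_mul_sq_sub, mul_pow, sq_abs, sq_abs]
    constructor <;> intro h <;> linarith
  refine Nat.card_eq_of_bijective
    (fun p => ⟨((6 * p.1.1 - 1).natAbs, 3 * (4 * p.1.2 - 1).natAbs), (hN _ _).mpr p.2⟩) ⟨?_, ?_⟩
  · rintro ⟨⟨a, b⟩, h⟩ ⟨⟨a', b'⟩, h'⟩ heq
    simp only [Subtype.mk.injEq, Prod.mk.injEq] at heq ⊢
    omega
  · rintro ⟨⟨x, y⟩, h⟩
    have ho := odd_of_sq_add_two_mul_sq (N := 3 * n + 2) (h.trans (by ring))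
    -- Since $24n+19\equiv 1$ modulo 3, every representation has $3\nmid x$ and $3\mid y$, so the
    -- parametrization misses none.
    have key : ∀ a b : ZMod 3, a ^ 2 + 2 * b ^ 2 = 1 → a.val ≠ 0 ∧ b.val = 0 := by decide
    have h24 : (24 : ZMod 3) = 0 := rfl
    have h19 : (19 : ZMod 3) = 1 := rfl
    have h3 := key x y (by
      have := congrArg (Nat.cast : ℕ → ZMod 3) h
      push_cast at this
      rw [this, h24, zero_mul, zero_add, h19])
    rw [ZMod.val_natCast, ZMod.val_natCast] at h3
    obtain ⟨a, ha⟩ : ∃ a : ℤ, (6 * a - 1).natAbs = x := by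
      rcases (by omega : x % 6 = 1 ∨ x % 6 = 5) with h | h
      · exact ⟨-((x : ℤ) / 6), by omega⟩
      · exact ⟨(x + 1 : ℤ) / 6, by omega⟩
    obtain ⟨b, hb⟩ : ∃ b : ℤ, 3 * (4 * b - 1).natAbs = y := by
      rcases (by omega : y % 12 = 3 ∨ y % 12 = 9) with h | h
      · exact ⟨-((y : ℤ) / 12), by omega⟩
      · exact ⟨(y + 3 : ℤ) / 12, by omega⟩
    subst ha hb
    exact ⟨⟨(a, b), (hN a b).mp h⟩, rfl⟩

theorem coeff_ell_mul_ell_modEq (n : ℕ) :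
    coeff n (ell 1 * ell 6 ^ 3) ≡ repCount (24 * n + 19) [ZMOD 2] := by
  have h : red 2 (ell 1 * ell 6 ^ 3) = red 2 ((∑' k : ℤ, X ^ pentagonal k) * psi (X ^ 6)) := by
    rw [map_mul, map_mul, map_pow, red_two_ell_one, red_two_psi (by norm_num)]
  rw [← coeff_pentagonal_mul_psi]
  exact (red_eq_iff 2).mp h n

theorem Pv_modEq_repCount (n : ℕ) : Pv (2 * n + 1) ≡ repCount (8 * n + 3) [ZMOD 2] := by
  have h := (red_eq_iff 2).mp red_two_oddPart n
  rwa [coeff_psi_mul_psi, oddPart, coeff_mk] at h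

theorem not_dvd_add_mul {p c j : ℕ} (hc : c.Coprime p) (hj : 1 ≤ j) (hj' : j ≤ p - 1) (n d : ℕ) :
    ¬ p ∣ c * p * n + c * j + d * p := by
  intro h
  have h1 : p ∣ c * j := by
    have h2 : c * p * n + c * j + d * p = c * j + p * (c * n + d) := by ring
    rw [h2] at h
    exact (Nat.dvd_add_left (dvd_mul_right _ _)).mp h
  have := Nat.le_of_dvd hj (hc.symm.dvd_of_dvd_mul_left h1)
  omega

/-! ### Descent at primes for which $-2$ is a nonresidue -/

section Descent

variable {p : ℕ} [Fact p.Prime]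

/-- If $y\not\equiv 0$, then $(x/y)^2=-2$ modulo $p$. -/
theorem dvd_of_dvd_sq_add_two_mul_sq (hp : ¬ IsSquare (-2 : ZMod p)) {x y : ℕ}
    (h : p ∣ x ^ 2 + 2 * y ^ 2) : p ∣ x ∧ p ∣ y := by
  have h0 : (x : ZMod p) ^ 2 + 2 * (y : ZMod p) ^ 2 = 0 := by
    have := (ZMod.natCast_eq_zero_iff _ p).mpr h
    push_cast at this
    exact this
  have hy : (y : ZMod p) = 0 := by
    by_contra hy
    refine hp ⟨x / y, ?_⟩
    field_simp
    linear_combination -h0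
  have hx : (x : ZMod p) = 0 := by
    rw [hy] at h0
    simpa using h0
  exact ⟨(ZMod.natCast_eq_zero_iff _ p).mp hx, (ZMod.natCast_eq_zero_iff _ p).mp hy⟩

theorem repCount_sq_mul (hp : ¬ IsSquare (-2 : ZMod p)) (N : ℕ) :
    repCount (p ^ 2 * N) = repCount N := by
  have hp0 : 0 < p := (Fact.out : p.Prime).pos
  have hN : ∀ x y : ℕ, (p * x) ^ 2 + 2 * (p * y) ^ 2 = p ^ 2 * N ↔ x ^ 2 + 2 * y ^ 2 = N := by
    intro x y
    rw [show (p * x) ^ 2 + 2 * (p * y) ^ 2 = p ^ 2 * (x ^ 2 + 2 * y ^ 2) by ring]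
    exact Nat.mul_right_inj (pow_pos hp0 2).ne'
  symm
  refine Nat.card_eq_of_bijective (fun q => ⟨(p * q.1.1, p * q.1.2), (hN _ _).mpr q.2⟩) ⟨?_, ?_⟩
  · rintro ⟨⟨a, b⟩, h⟩ ⟨⟨a', b'⟩, h'⟩ heq
    simpa [hp0.ne'] using heq
  · rintro ⟨⟨x, y⟩, h⟩
    obtain ⟨⟨a, rfl⟩, ⟨b, rfl⟩⟩ := dvd_of_dvd_sq_add_two_mul_sq (x := x) (y := y) hp
      (by rw [h, sq, mul_assoc]; exact dvd_mul_right _ _)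
    exact ⟨⟨(a, b), (hN a b).mp h⟩, rfl⟩

theorem repCount_pow_mul (hp : ¬ IsSquare (-2 : ZMod p)) (α N : ℕ) :
    repCount (p ^ (2 * α) * N) = repCount N := by
  induction α with
  | zero => simp
  | succ α ih => rw [mul_add, mul_one, add_comm, pow_add, mul_assoc, repCount_sq_mul hp, ih]

theorem repCount_mul_eq_zero (hp : ¬ IsSquare (-2 : ZMod p)) {N : ℕ} (hN : ¬ p ∣ N) :
    repCount (p * N) = 0 := by
  have : IsEmpty {q : ℕ × ℕ // q.1 ^ 2 + 2 * q.2 ^ 2 = p * N} := by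
    refine ⟨fun ⟨⟨x, y⟩, h⟩ => hN ?_⟩
    obtain ⟨⟨a, rfl⟩, ⟨b, rfl⟩⟩ := dvd_of_dvd_sq_add_two_mul_sq (x := x) (y := y) hp
      (by rw [h]; exact dvd_mul_right _ _)
    refine ⟨a ^ 2 + 2 * b ^ 2, ?_⟩
    apply Nat.eq_of_mul_eq_mul_left (Fact.out : p.Prime).pos
    rw [← h]
    ring
  exact Nat.card_of_isEmpty

theorem repCount_pow_odd_mul_eq_zero (hp : ¬ IsSquare (-2 : ZMod p)) (α : ℕ) {N : ℕ}
    (hN : ¬ p ∣ N) : repCount (p ^ (2 * α + 1) * N) = 0 := by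
  rw [pow_succ, mul_assoc, repCount_pow_mul hp, repCount_mul_eq_zero hp hN]

end Descent

/-! ### The infinite families -/

theorem pow_two_mul_mod_eight {p : ℕ} (hp : p % 2 = 1) (α : ℕ) : p ^ (2 * α) % 8 = 1 := by
  have h : p ^ 2 % 8 = 1 := by
    rw [Nat.pow_mod]
    rcases (by omega : p % 8 = 1 ∨ p % 8 = 3 ∨ p % 8 = 5 ∨ p % 8 = 7) with h | h | h | h <;> rw [h]
  rw [pow_mul, Nat.pow_mod, h, one_pow]
  rfl

theorem pow_two_mul_mod_three {p : ℕ} (hp : p % 3 ≠ 0) (α : ℕ) : p ^ (2 * α) % 3 = 1 := by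
  have h : p ^ 2 % 3 = 1 := by
    rw [Nat.pow_mod]
    rcases (by omega : p % 3 = 1 ∨ p % 3 = 2) with h | h <;> rw [h]
  rw [pow_mul, Nat.pow_mod, h, one_pow]
  rfl

theorem Pv_modEq_repCount_of_eq {m N : ℕ} (hm : m % 2 = 1) (hN : 4 * m = N + 1) :
    Pv m ≡ repCount N [ZMOD 2] := by
  obtain ⟨k, rfl⟩ : ∃ k, m = 2 * k + 1 := ⟨m / 2, by omega⟩
  obtain rfl : N = 8 * k + 3 := by omega
  exact Pv_modEq_repCount k

theorem modEq_six_of_modEq {a b : ℤ} (h2 : a ≡ b [ZMOD 2]) (h3 : a ≡ b [ZMOD 3]) :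
    a ≡ b [ZMOD 6] := by
  unfold Int.ModEq at *
  omega

theorem Pv_modEq_zero_three {m : ℕ} (hm : m % 6 = 5) : Pv m ≡ 0 [ZMOD 3] := by
  obtain ⟨k, rfl⟩ : ∃ k, m = 6 * k + 5 := ⟨m / 6, by omega⟩
  exact Pv_six_mul_add_five k

section Families

variable {p : ℕ} [Fact p.Prime]

theorem Pv_two_family (hp3 : 3 ≤ p) (hp : ¬ IsSquare (-2 : ZMod p)) (α : ℕ) :
    SeriesModEq 2
      (PowerSeries.mk fun n => Pv (2 * p ^ (2 * α) * n + (3 * p ^ (2 * α) + 1) / 4))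
      (psi X * psi (X ^ 2)) ∧
    ∀ n j : ℕ, 1 ≤ j → j ≤ p - 1 →
      Pv (2 * p ^ (2 * α + 2) * n + 2 * p ^ (2 * α + 1) * j + (3 * p ^ (2 * α + 2) + 1) / 4)
        ≡ 0 [ZMOD 2] := by
  have hodd : p % 2 = 1 := (Fact.out : p.Prime).eq_two_or_odd.resolve_left (by omega)
  constructor
  · intro n
    rw [coeff_mk, coeff_psi_mul_psi, ← repCount_pow_mul hp α (8 * n + 3)]
    have h8 := pow_two_mul_mod_eight hodd α
    generalize p ^ (2 * α) = P at *
    have e1 : P * (8 * n + 3) = 4 * (2 * P * n) + 3 * P := by ring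
    have e2 : 2 * P * n = 2 * (P * n) := by ring
    apply Pv_modEq_repCount_of_eq <;> omega
  · intro n j hj hj'
    have hcop : Nat.Coprime 8 p :=
      Nat.Coprime.pow_left 3 ((Nat.coprime_primes Nat.prime_two Fact.out).mpr (by omega))
    -- For the index $m$ of the claim, $4m-1=p^{2\alpha+1}(8pn+8j+3p)$, and $p\nmid 8j$.
    have h0 := repCount_pow_odd_mul_eq_zero hp α (not_dvd_add_mul hcop hj hj' n 3)
    have h8 := pow_two_mul_mod_eight hodd (α + 1)
    rw [show 2 * (α + 1) = 2 * α + 2 by ring] at h8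
    have e0 : p ^ (2 * α + 1) * (8 * p * n + 8 * j + 3 * p) =
        4 * (2 * p ^ (2 * α + 2) * n) + 4 * (2 * p ^ (2 * α + 1) * j) + 3 * p ^ (2 * α + 2) := by
      ring
    rw [e0] at h0
    have e2 : 2 * p ^ (2 * α + 2) * n = 2 * (p ^ (2 * α + 2) * n) := by ring
    have e3 : 2 * p ^ (2 * α + 1) * j = 2 * (p ^ (2 * α + 1) * j) := by ring
    refine (Pv_modEq_repCount_of_eq (N := _) ?_ ?_).trans (by rw [h0]; rfl) <;> omega

theorem Pv_six_family (hp5 : 5 ≤ p) (hp : ¬ IsSquare (-2 : ZMod p)) (α : ℕ) :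
    SeriesModEq 6
      (PowerSeries.mk fun n => Pv (6 * p ^ (2 * α) * n + (19 * p ^ (2 * α) + 1) / 4))
      (3 * ell 1 * ell 6 ^ 3) ∧
    ∀ n j : ℕ, 1 ≤ j → j ≤ p - 1 →
      Pv (6 * p ^ (2 * α + 2) * n + 6 * p ^ (2 * α + 1) * j + (19 * p ^ (2 * α + 2) + 1) / 4)
        ≡ 0 [ZMOD 6] := by
  have hodd : p % 2 = 1 := (Fact.out : p.Prime).eq_two_or_odd.resolve_left (by omega)
  have h3p : p % 3 ≠ 0 := fun h => by
    have := (Nat.prime_dvd_prime_iff_eq Nat.prime_three (Fact.out : p.Prime)).mp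
      (Nat.dvd_of_mod_eq_zero h)
    omega
  constructor
  · intro n
    have h8 := pow_two_mul_mod_eight hodd α
    have h3 := pow_two_mul_mod_three h3p α
    have hrep := repCount_pow_mul hp α (24 * n + 19)
    have hcoeff : coeff n (3 * ell 1 * ell 6 ^ 3) = 3 * coeff n (ell 1 * ell 6 ^ 3) := by
      rw [mul_assoc, show (3 : ℤ⟦X⟧) = C 3 from (map_ofNat C 3).symm, coeff_C_mul]
    have hell := coeff_ell_mul_ell_modEq n
    rw [coeff_mk, hcoeff]
    generalize p ^ (2 * α) = P at *
    have e1 : P * (24 * n + 19) = 4 * (6 * P * n) + 19 * P := by ring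
    have e2 : 6 * P * n = 6 * (P * n) := by ring
    apply modEq_six_of_modEq
    · have h := Pv_modEq_repCount_of_eq (m := 6 * P * n + (19 * P + 1) / 4)
        (N := P * (24 * n + 19)) (by omega) (by omega)
      rw [hrep] at h
      refine (h.trans hell.symm).trans ?_
      unfold Int.ModEq
      omega
    -- Since $P\equiv 1$ modulo 24, the index is $5$ modulo 6; the right side carries a factor 3.
    · refine (Pv_modEq_zero_three (by omega)).trans ?_
      unfold Int.ModEq
      omega
  · intro n j hj hj'
    have hcop : Nat.Coprime 24 p := Nat.Coprime.mul_left
      (Nat.Coprime.pow_left 3 ((Nat.coprime_primes Nat.prime_two Fact.out).mpr (by omega)) :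
        Nat.Coprime 8 p)
      ((Nat.coprime_primes Nat.prime_three Fact.out).mpr (by omega))
    have h0 := repCount_pow_odd_mul_eq_zero hp α (not_dvd_add_mul hcop hj hj' n 19)
    have h8 := pow_two_mul_mod_eight hodd (α + 1)
    have h3 := pow_two_mul_mod_three h3p (α + 1)
    rw [show 2 * (α + 1) = 2 * α + 2 by ring] at h8 h3
    have e0 : p ^ (2 * α + 1) * (24 * p * n + 24 * j + 19 * p) =
        4 * (6 * p ^ (2 * α + 2) * n) + 4 * (6 * p ^ (2 * α + 1) * j) +
          19 * p ^ (2 * α + 2) := by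
      ring
    rw [e0] at h0
    have e2 : 6 * p ^ (2 * α + 2) * n = 6 * (p ^ (2 * α + 2) * n) := by ring
    have e3 : 6 * p ^ (2 * α + 1) * j = 6 * (p ^ (2 * α + 1) * j) := by ring
    apply modEq_six_of_modEq
    · refine (Pv_modEq_repCount_of_eq (N := _) ?_ ?_).trans (by rw [h0]; rfl) <;> omega
    · exact Pv_modEq_zero_three (by omega)

/-- $-18=3^2\cdot(-2)$. -/
theorem not_isSquare_neg_two_of_neg_eighteen (h : ¬ IsSquare (-18 : ZMod p)) :
    ¬ IsSquare (-2 : ZMod p) := by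
  rintro ⟨a, ha⟩
  exact h ⟨3 * a, by linear_combination 9 * ha⟩

end Families

end

end MockTheta

open PowerSeries MockTheta in
theorem theorem3p3 :
    (∀ n : ℕ, Pv (6 * n + 5) ≡ 0 [ZMOD 3]) ∧
    (∀ (p : ℕ) [Fact p.Prime], 3 ≤ p → legendreSym p (-2) = -1 → ∀ α : ℕ,
      SeriesModEq 2
        (PowerSeries.mk fun n => Pv (2 * p ^ (2 * α) * n + (3 * p ^ (2 * α) + 1) / 4))
        (psi X * psi (X ^ 2)) ∧
      ∀ n j : ℕ, 1 ≤ j → j ≤ p - 1 →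
        Pv (2 * p ^ (2 * α + 2) * n + 2 * p ^ (2 * α + 1) * j + (3 * p ^ (2 * α + 2) + 1) / 4)
          ≡ 0 [ZMOD 2]) ∧
    (∀ (p : ℕ) [Fact p.Prime], 5 ≤ p → legendreSym p (-18) = -1 → ∀ α : ℕ,
      SeriesModEq 6
        (PowerSeries.mk fun n => Pv (6 * p ^ (2 * α) * n + (19 * p ^ (2 * α) + 1) / 4))
        (3 * ell 1 * ell 6 ^ 3) ∧
      ∀ n j : ℕ, 1 ≤ j → j ≤ p - 1 →
        Pv (6 * p ^ (2 * α + 2) * n + 6 * p ^ (2 * α + 1) * j + (19 * p ^ (2 * α + 2) + 1) / 4)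
          ≡ 0 [ZMOD 6]) := by 
  refine ⟨Pv_six_mul_add_five, ?_, ?_⟩
  · intro p _ hp3 hp α
    refine Pv_two_family hp3 ?_ α
    simpa using (legendreSym.eq_neg_one_iff p).mp hp
  · intro p _ hp5 hp α
    refine Pv_six_family hp5 (not_isSquare_neg_two_of_neg_eighteen ?_) α
    simpa using (legendreSym.eq_neg_one_iff p).mp hp
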